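/- **Setting.** Let $(X,Y,Z)$ be a random element of $\mathcal X\times\mathcal Y\times\mathbb R^d$ ($d\ge 1$) with ranges $\mathcal X,\mathcal Y,\mathcal Z$ (more generally, $\mathcal X,\mathcal Y$ are any measurable spaces in which $X,Y$ take their values and $\mathcal Z\subset\mathbb R^d$ is any set with $Z\in\mathcal Z$ a.s.), and let $(X_i,Y_i,Z_i)$, $i\ge1$, be i.i.d. copies of $(X,Y,Z)$. Let $\Lambda_1,\Lambda_2,\Lambda_3$ be infinite sets of positive integers and $\phi_{p,i}:\mathcal X\to\mathbb R$ ($1\le i\le p$), $\psi_{q,j}:\mathcal Y\to\mathbb R$ ($1\le j\le q$), $\theta_{r,k}:\mathbb R^d\to\mathbb R$ ($1\le k\le r$) measurable functions ($p\in\Lambda_1,q\in\Lambda_2,r\in\Lambda_3$). **Basis approximation.** For all $\alpha(X,Z),\beta(Y,Z)$ with finite second moments, $$\lim_{p,r\to\infty}\inf_{a}E\Big(\alpha(X,Z)-\sum_{i\le p,\,k\le r}a(i,k)\phi_{p,i}(X)\theta_{r,k}(Z)\Big)^2=0,\qquad \lim_{q,r\to\infty}\inf_{b}E\Big(\beta(Y,Z)-\sum_{j\le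 q,\,k\le r}b(j,k)\psi_{q,j}(Y)\theta_{r,k}(Z)\Big)^2=0$$ (limits along $p\in\Lambda_1,q\in\Lambda_2,r\in\Lambda_3$); and for all $p\in\Lambda_1,q\in\Lambda_2$ there are constants with $\sum_i a_{p,0,i}\phi_{p,i}(x)=1=\sum_j b_{q,0,j}\psi_{q,j}(y)$ for all $x\in\mathcal X,y\in\mathcal Y$. **(R1)** There is a $\sigma$-finite measure $\mu$ on $\mathcal X\times\mathcal Y$ such that for every $z\in\mathcal Z$ the conditional distribution of $(X,Y)$ given $Z=z$ has a density $f(\cdot|z)$ with respect to $\mu$ (jointly measurable in all arguments), and $Z$ has a Lebesgue density $f_Z$; $f(x,y|z)$ and $f_Z(z)$ are twice differentiable in $z$ on the interior of $\mathcal Z$. **(R2)** There is a $\mu$-integrable $H(x,y)$ that bounds $|f(x,y|z)|$ for $z\in\mathcal Z$, and $|\partial_{z_i}f(x,y|z)|$ and $|\partial_{z_i}\partial_{z_j}f(x,y|z)|$ for all $i,j$ and all $z$ in the interior of $\mathcal Z$. **(R3)** There are constants $c_0,c_1$ such that $|f_Z|\le c_0$ on $\mathcal Z$, all first and second partial derivatives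 of $f_Z$ are bounded by $c_0$ in absolute value on the interior of $\mathcal Z$, and $f_Z>0$, $1/f_Z\le c_1$ on $\mathcal Z$. **(K1)** $k_0:\mathbb R^d\to\mathbb R$ is measurable, $k_0\ge0$, $\sup k_0<\infty$, $\int k_0=1$, $\int u\,k_0(u)\,du=0$, $\int\|u\|^2k_0(u)\,du<\infty$. **(K2)** There are $\gamma_2,\gamma_3>0$ with $k_0(a)\le\gamma_2^d e^{-\gamma_3\|a\|^2}$ for all $a\in\mathbb R^d$. **Sequences.** Let $h_n,\varepsilon_n>0$ ($n\ge1$) with $c_{3,1}n^{-\alpha}\le h_n\le c_{3,2}n^{-\alpha}$ for some $c_{3,1},c_{3,2}>0$ and $1/(d+4)<\alpha<1/d$, and $h_n/\varepsilon_n=O(n^{-\beta})$ for some $\beta>0$. For every $n$ let $n_Z\in\mathbb N$, $p_n\in\Lambda_1$, $q_n\in\Lambda_2$, and let $z_1,\dots,z_{n_Z}$ (all of these may depend on $n$) be points of $\mathcal Z(\varepsilon_n)=\{z\in\mathcal Z:\{z':\|z'-z\|<\varepsilon_n\}\subset\mathcal Z\}$ such that, for large $n$, $\|z_k-z_{k'}\|\ge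 h_n$ whenever $k\ne k'$. **(B1)** $|\phi_{p,i}|\le1$ and $|\psi_{q,j}|\le1$ for $p\in\Lambda_1$, $q\in\Lambda_2$. **(B2)** $\delta_n>0$, and for $1\le k\le n_Z$ the smallest eigenvalues of the matrices $V_{1,1}(z_k)=\big(E(\phi_{p_n,i}(X)\phi_{p_n,j}(X)|Z=z_k)\big)_{i,j}$ and $V_{2,2}(z_k)=\big(E(\psi_{q_n,i}(Y)\psi_{q_n,j}(Y)|Z=z_k)\big)_{i,j}$ are at least $\delta_n$, where $E(g(X,Y)|Z=z)=\int g\,f(\cdot|z)\,d\mu$. Finally, suppose that $$n_Z(p_n+q_n)^2\max\{1,\delta_n^{-1}(p_n+q_n)\}=O\big((\ln n)^{1/16}\big).$$ **Quantities.** Let $\Sigma_{\phi,p}(z)$, $\Sigma_{\psi,q}(z)$, $\Sigma_{\phi,\psi,p,q}(z)$ be the conditional covariance matrices given $Z=z$ of $(\phi_{p,i}(X))_i$, of $(\psi_{q,j}(Y))_j$, and between the two, and let $\rho_{p,q}(z)=\max_{a,b}a^T\Sigma_{\phi,\psi,p,q}(z)b$ over all $a\in\mathbb R^p,b\in\mathbb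 R^q$ with $a^T\Sigma_{\phi,p}(z)a=1=b^T\Sigma_{\psi,q}(z)b$ (and $\rho_{p,q}(z)=0$ if no such $a,b$ exist). Let $\hat\rho(z)$ be obtained from $\rho_{p_n,q_n}(z)$ by replacing every $E(g(X,Y)|Z=z)$ in these matrices by $$\hat E(g(X,Y)|Z=z)=\frac{\sum_{i=1}^n g(X_i,Y_i)k_{h_n}(z-Z_i)}{\sum_{i=1}^n k_{h_n}(z-Z_i)},\qquad k_h(u)=h^{-d}k_0(u/h),$$ (with $\hat\rho(z)=0$ if the denominator vanishes), and let $\hat f_Z(z)=(nh_n^d)^{-1}\sum_{i=1}^n k_0\big(h_n^{-1}(z-Z_i)\big)$. **Conclusion.** Then $$\sum_{k=1}^{n_Z}\big(\hat\rho^2(z_k)-\rho^2_{p_n,q_n}(z_k)\big)^2=O_P\big((nh_n^d)^{-1}(\ln n)^{1/4}\big)$$ and $$\Big(\sum_{k=1}^{n_Z}\hat f_Z(z_k)\hat\rho^2(z_k)-\sum_{k=1}^{n_Z}f_Z(z_k)\rho^2_{p_n,q_n}(z_k)\Big)^2=O_P\Big(\frac{(\ln n)^{5/16}}{nh_n^d}\Big).$$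 -/

import Mathlib

open MeasureTheory ProbabilityTheory Filter Topology Asymptotics Matrix

noncomputable section

/-- `R n = O_P(r n)`: for every `ε > 0` there is a constant `M` with
`P(|R n| > M * r n) ≤ ε` for all large `n`. -/
def IsBigOP {Ω : Type*} [MeasurableSpace Ω] (P : Measure Ω) (R : ℕ → Ω → ℝ) (r : ℕ → ℝ) : Prop :=
  ∀ ε : ℝ, 0 < ε → ∃ M : ℝ, 0 < M ∧
    ∀ᶠ n in atTop, P {ω | M * r n < |R n ω|} ≤ ENNReal.ofReal ε

/-- The partial derivative `∂g/∂z_i` at `z`. -/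
def partialDer {d : ℕ} (i : Fin d) (g : EuclideanSpace ℝ (Fin d) → ℝ)
    (z : EuclideanSpace ℝ (Fin d)) : ℝ :=
  fderiv ℝ g z (EuclideanSpace.single i 1)

/-- `g` is twice differentiable at every point of `U` (used for open `U`). -/
def TwiceDiffOn {d : ℕ} (g : EuclideanSpace ℝ (Fin d) → ℝ)
    (U : Set (EuclideanSpace ℝ (Fin d))) : Prop :=
  ∀ z ∈ U, DifferentiableAt ℝ g z ∧ DifferentiableAt ℝ (fderiv ℝ g) z

/-- The points of `S` whose open `ε`-ball is contained in `S`. -/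
def innerSet {d : ℕ} (S : Set (EuclideanSpace ℝ (Fin d))) (ε : ℝ) :
    Set (EuclideanSpace ℝ (Fin d)) :=
  {z ∈ S | {z' | ‖z' - z‖ < ε} ⊆ S}

/-! ### Canonical correlation for a moment functional

Here `E` maps a function of `(x, y)` to a number: either the conditional expectation
`g ↦ E(g(X,Y) | Z = z)` or its kernel estimator at `z`. -/

section Moments

variable {𝒳 𝒴 : Type*}

/-- `E(u_i v_j) - E(u_i) E(v_j)`. -/
def covMatrix (E : (𝒳 × 𝒴 → ℝ) → ℝ) {p q : ℕ} (u : Fin p → 𝒳 × 𝒴 → ℝ)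
    (v : Fin q → 𝒳 × 𝒴 → ℝ) : Matrix (Fin p) (Fin q) ℝ :=
  Matrix.of fun i j => E (fun w => u i w * v j w) - E (u i) * E (v j)

/-- `E(u_i u_j)`. -/
def secondMomentMatrix (E : (𝒳 × 𝒴 → ℝ) → ℝ) {p : ℕ} (u : Fin p → 𝒳 × 𝒴 → ℝ) :
    Matrix (Fin p) (Fin p) ℝ :=
  Matrix.of fun i j => E (fun w => u i w * u j w)

/-- `max a^T S₁₂ b` over all vectors `a`, `b` with `a^T S₁₁ a = 1 = b^T S₂₂ b`. If `S₁₁` or `S₂₂`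
is the zero matrix, no such pair exists and the value is `sSup ∅ = 0`. -/
def maxCorr {p q : ℕ} (S₁₁ : Matrix (Fin p) (Fin p) ℝ) (S₂₂ : Matrix (Fin q) (Fin q) ℝ)
    (S₁₂ : Matrix (Fin p) (Fin q) ℝ) : ℝ :=
  sSup {t | ∃ (a : Fin p → ℝ) (b : Fin q → ℝ),
    a ⬝ᵥ (S₁₁ *ᵥ a) = 1 ∧ b ⬝ᵥ (S₂₂ *ᵥ b) = 1 ∧ t = a ⬝ᵥ (S₁₂ *ᵥ b)}

/-- The largest (centered) canonical correlation, under `E`, between linear combinations of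
`φ_1(x), …, φ_p(x)` and of `ψ_1(y), …, ψ_q(y)`. -/
def maxBasisCorr (E : (𝒳 × 𝒴 → ℝ) → ℝ) {p q : ℕ} (φ : Fin p → 𝒳 → ℝ) (ψ : Fin q → 𝒴 → ℝ) : ℝ :=
  maxCorr (covMatrix E (fun i w => φ i w.1) (fun i w => φ i w.1))
    (covMatrix E (fun j w => ψ j w.2) (fun j w => ψ j w.2))
    (covMatrix E (fun i w => φ i w.1) (fun j w => ψ j w.2))

/-- `E(g(X,Y) | Z = z)`, computed with the conditional density `f(x,y|z)` with respect to `μ`. -/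
def condMean {d : ℕ} [MeasurableSpace 𝒳] [MeasurableSpace 𝒴] (μ : Measure (𝒳 × 𝒴))
    (f : 𝒳 × 𝒴 → EuclideanSpace ℝ (Fin d) → ℝ) (z : EuclideanSpace ℝ (Fin d))
    (g : 𝒳 × 𝒴 → ℝ) : ℝ :=
  ∫ w, g w * f w z ∂μ

/-- `k_h(z) = h^{-d} k₀(z / h)`. -/
def scaledKernel {d : ℕ} (k₀ : EuclideanSpace ℝ (Fin d) → ℝ) (h : ℝ)
    (z : EuclideanSpace ℝ (Fin d)) : ℝ :=
  (h ^ d)⁻¹ * k₀ (h⁻¹ • z)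

/-- The kernel estimator of `E(g(X,Y) | Z = z)` from the observations
`(x i, y i, z' i)`, `i < n`. -/
def kernelMean {d : ℕ} (k₀ : EuclideanSpace ℝ (Fin d) → ℝ) (n : ℕ) (h : ℝ)
    (x : ℕ → 𝒳) (y : ℕ → 𝒴) (z' : ℕ → EuclideanSpace ℝ (Fin d))
    (z : EuclideanSpace ℝ (Fin d)) (g : 𝒳 × 𝒴 → ℝ) : ℝ :=
  (∑ i ∈ Finset.range n, g (x i, y i) * scaledKernel k₀ h (z - z' i)) /
    ∑ i ∈ Finset.range n, scaledKernel k₀ h (z - z' i)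

/-- The kernel density estimator `(n h^d)⁻¹ ∑ k₀((z - Z_i)/h)` of `f_Z(z)`. -/
def kernelDensity {d : ℕ} (k₀ : EuclideanSpace ℝ (Fin d) → ℝ) (n : ℕ) (h : ℝ)
    (z' : ℕ → EuclideanSpace ℝ (Fin d)) (z : EuclideanSpace ℝ (Fin d)) : ℝ :=
  ((n : ℝ) * h ^ d)⁻¹ * ∑ i ∈ Finset.range n, k₀ (h⁻¹ • (z - z' i))

end Moments

/-! ### The assumptions -/

/-- Every square integrable `α(X,Z)` is the mean square limit, as `p, r → ∞` with `p ∈ Λ` and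
`r ∈ Λ'`, of best approximations by combinations of the products `φ_{p,i}(X) θ_{r,k}(Z)`. -/
def TensorApprox {d : ℕ} {Ω 𝒳 : Type*} [MeasurableSpace Ω] [MeasurableSpace 𝒳] (P : Measure Ω)
    (X : Ω → 𝒳) (Z : Ω → EuclideanSpace ℝ (Fin d)) (Λ Λ' : Set ℕ)
    (φ : (p : ℕ) → Fin p → 𝒳 → ℝ) (θ : (r : ℕ) → Fin r → EuclideanSpace ℝ (Fin d) → ℝ) : Prop :=
  ∀ α : 𝒳 × EuclideanSpace ℝ (Fin d) → ℝ, Measurable α →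
    MemLp (fun ω => α (X ω, Z ω)) 2 P →
    Tendsto
      (fun s : ℕ × ℕ => ⨅ a : Fin s.1 → Fin s.2 → ℝ,
        ∫⁻ ω, ENNReal.ofReal ((α (X ω, Z ω) -
          ∑ i, ∑ k, a i k * φ s.1 i (X ω) * θ s.2 k (Z ω)) ^ 2) ∂P)
      (atTop ⊓ 𝓟 (Λ ×ˢ Λ')) (𝓝 0)

/-- The constant function `1` is a linear combination of `φ_{p,1}, …, φ_{p,p}`, `p ∈ Λ`. -/
def SpansOne {𝒳 : Type*} (Λ : Set ℕ) (φ : (p : ℕ) → Fin p → 𝒳 → ℝ) : Prop :=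
  ∀ p ∈ Λ, ∃ a : Fin p → ℝ, ∀ x, ∑ i, a i * φ p i x = 1

section Regularity

variable {d : ℕ} {Ω 𝒳 𝒴 : Type*} [MeasurableSpace Ω] [MeasurableSpace 𝒳] [MeasurableSpace 𝒴]

/-- For `z ∈ 𝒵` the conditional distribution of `(X,Y)` given `Z = z` has density `f(·|z)` with
respect to `μ`, `Z` has Lebesgue density `fZ`, and both densities are twice differentiable
in `z`. -/
structure CondR1 (P : Measure Ω) (X : Ω → 𝒳) (Y : Ω → 𝒴) (Z : Ω → EuclideanSpace ℝ (Fin d))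
    (𝒵 : Set (EuclideanSpace ℝ (Fin d))) (μ : Measure (𝒳 × 𝒴))
    (f : 𝒳 × 𝒴 → EuclideanSpace ℝ (Fin d) → ℝ) (fZ : EuclideanSpace ℝ (Fin d) → ℝ) : Prop where
  measurable_f : Measurable (Function.uncurry f)
  f_nonneg : ∀ z ∈ 𝒵, ∀ w, 0 ≤ f w z
  f_mass : ∀ z ∈ 𝒵, ∫⁻ w, ENNReal.ofReal (f w z) ∂μ = 1
  condDensity : ∀ A : Set (𝒳 × 𝒴), MeasurableSet A →
    ∀ B : Set (EuclideanSpace ℝ (Fin d)), MeasurableSet B →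
      P {ω | (X ω, Y ω) ∈ A ∧ Z ω ∈ B} =
        ∫⁻ z in B, (∫⁻ w in A, ENNReal.ofReal (f w z) ∂μ) ∂(P.map Z)
  measurable_fZ : Measurable fZ
  fZ_nonneg : ∀ z, 0 ≤ fZ z
  density : P.map Z = volume.withDensity fun z => ENNReal.ofReal (fZ z)
  f_twice : ∀ w, TwiceDiffOn (f w) (interior 𝒵)
  fZ_twice : TwiceDiffOn fZ (interior 𝒵)

/-- The conditional density and its first two derivatives in `z` are dominated by a
`μ`-integrable function of `(x, y)`. -/
def CondR2 (𝒵 : Set (EuclideanSpace ℝ (Fin d))) (μ : Measure (𝒳 × 𝒴))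
    (f : 𝒳 × 𝒴 → EuclideanSpace ℝ (Fin d) → ℝ) : Prop :=
  ∃ H : 𝒳 × 𝒴 → ℝ, Integrable H μ ∧
    (∀ w, ∀ z ∈ 𝒵, |f w z| ≤ H w) ∧
    (∀ w, ∀ z ∈ interior 𝒵, ∀ i, |partialDer i (f w) z| ≤ H w) ∧
    (∀ w, ∀ z ∈ interior 𝒵, ∀ i j, |partialDer i (partialDer j (f w)) z| ≤ H w)

end Regularity

/-- The density of `Z` and its first two derivatives are bounded, and the density is bounded away
from zero on `𝒵`. -/
def CondR3 {d : ℕ} (𝒵 : Set (EuclideanSpace ℝ (Fin d))) (fZ : EuclideanSpace ℝ (Fin d) → ℝ) :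
    Prop :=
  ∃ c₀ c₁ : ℝ,
    (∀ z ∈ 𝒵, |fZ z| ≤ c₀) ∧
    (∀ z ∈ interior 𝒵, ∀ i, |partialDer i fZ z| ≤ c₀) ∧
    (∀ z ∈ interior 𝒵, ∀ i j, |partialDer i (partialDer j fZ) z| ≤ c₀) ∧
    (∀ z ∈ 𝒵, 0 < fZ z ∧ 1 / fZ z ≤ c₁)

/-- `k₀` is a bounded probability density with mean zero and finite second moment. -/
structure CondK1 {d : ℕ} (k₀ : EuclideanSpace ℝ (Fin d) → ℝ) : Prop where
  measurable : Measurable k₀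
  nonneg : ∀ u, 0 ≤ k₀ u
  bounded : ∃ C, ∀ u, k₀ u ≤ C
  integrable : Integrable k₀
  integral_one : ∫ u, k₀ u = 1
  integrable_sq : Integrable fun u => ‖u‖ ^ 2 * k₀ u
  integrable_id : Integrable fun u => k₀ u • u
  mean_zero : ∫ u, k₀ u • u = 0

/-- `k₀` has Gaussian tails. -/
def CondK2 {d : ℕ} (k₀ : EuclideanSpace ℝ (Fin d) → ℝ) : Prop :=
  ∃ γ₂ γ₃ : ℝ, 0 < γ₂ ∧ 0 < γ₃ ∧ ∀ a, k₀ a ≤ γ₂ ^ d * Real.exp (-γ₃ * ‖a‖ ^ 2)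

end

/-! The conditional mean and, unless its denominator vanishes, the kernel estimator are both
integrals against probability measures: the conditional law and a weighted empirical measure. The
canonical correlation is thus a functional of a probability measure with values in [0,1]. The
theorem follows from a deterministic stability estimate for this functional and an L² bound for
kernel averages.

Stability is `abs_corrSup_sub_corrSup_le`. Since 1 lies in both spans, the covariance matrices are
singular, so nothing is inverted. Instead, 1 in the span permits centring within the span, which
makes the correlation the least c ≥ 0 with |cov(U,V)| ≤ c‖U‖₂‖V‖₂ for all U, V in the two spans,
with uncentered norms (`abs_cov_le_corrSup_mul_sq`, `corrSup_le_of_forall`). The eigenvalue bound δ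
controls the coefficients of U by ‖U‖₂, so an error η in the moments perturbs ‖U‖₂², ‖V‖₂² and the
covariance by a relative amount of order τ = (p+q)η/δ, and the correlation by O(τ). Large errors, in
particular a denominator near zero, need no exceptional event: there the claimed bound exceeds 1 and
is trivial.

The L² bound is `CondR1.exists_integral_sq_kernelAvg_sub_le`. The variance is O(1/(nh^d)). The bias
(`CondR1.exists_abs_bias_le`) is O(h²) from a Taylor expansion in the ball of radius ε_n, plus a
kernel tail outside it. As α > 1/(d+4), h⁴ is O(1/(nh^d)); as ε_n/h_n grows at least like n^β,
Gaussian decay makes the tail negligible.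

Finally both squared errors are dominated by one random variable whose mean is at most a constant
times n_Z²(p+q)²max{1,(p+q)/δ}²/(nh^d). The growth condition turns this into (ln n)^{1/8}/(nh^d),
and Markov's inequality gives both rates, since 1/8 is below 1/4 and 5/16. -/

noncomputable section

/-! ### Covariance inequalities -/

section Covariance

variable {W : Type*} [MeasurableSpace W] {ν : Measure W}

/-- Cauchy–Schwarz for the covariance. -/
theorem sq_covariance_le [IsFiniteMeasure ν] {U V : W → ℝ} (hU : MemLp U 2 ν) (hV : MemLp V 2 ν) :
    cov[U, V; ν] ^ 2 ≤ Var[U; ν] * Var[V; ν] := by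
  have key : ∀ t : ℝ, 0 ≤ Var[V; ν] * (t * t) + (2 * cov[U, V; ν]) * t + Var[U; ν] := by
    intro t
    have h := variance_nonneg (fun w => U w + t * V w) ν
    rw [variance_fun_add hU (hV.const_mul t), variance_const_mul,
      covariance_const_mul_right] at h
    linarith
  have := discrim_le_zero key
  unfold discrim at this
  nlinarith

theorem abs_covariance_le [IsFiniteMeasure ν] {U V : W → ℝ} (hU : MemLp U 2 ν)
    (hV : MemLp V 2 ν) : |cov[U, V; ν]| ≤ √Var[U; ν] * √Var[V; ν] := by
  rw [← Real.sqrt_mul (variance_nonneg _ _)]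
  exact Real.abs_le_sqrt (sq_covariance_le hU hV)

theorem memLp_two_of_abs_le_one [IsFiniteMeasure ν] {g : W → ℝ} (hg : Measurable g)
    (hb : ∀ w, |g w| ≤ 1) : MemLp g 2 ν :=
  MemLp.of_bound hg.aestronglyMeasurable 1 (ae_of_all _ hb)

theorem memLp_sum_mul {ι : Type*} [Fintype ι] {u : ι → W → ℝ} (hu : ∀ i, MemLp (u i) 2 ν)
    (a : ι → ℝ) : MemLp (fun w => ∑ i, a i * u i w) 2 ν :=
  memLp_finsetSum _ fun i _ => (hu i).const_mul (a i)

end Covariance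

/-! ### Canonical correlation as a functional of a probability measure -/

section Correlation

variable {𝒳 𝒴 : Type*} [MeasurableSpace 𝒳] [MeasurableSpace 𝒴] {ν ν' : Measure (𝒳 × 𝒴)}
  {p q : ℕ} {u : Fin p → 𝒳 × 𝒴 → ℝ} {v : Fin q → 𝒳 × 𝒴 → ℝ}

/-- Bilinearity of the covariance: this replaces matrices by random variables, so that
Cauchy–Schwarz and centring become available. -/
theorem dotProduct_covMatrix_mulVec [IsProbabilityMeasure ν] (hu : ∀ i, MemLp (u i) 2 ν)
    (hv : ∀ j, MemLp (v j) 2 ν) (a : Fin p → ℝ) (b : Fin q → ℝ) :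
    a ⬝ᵥ (covMatrix (fun g => ∫ w, g w ∂ν) u v *ᵥ b) =
      cov[fun w => ∑ i, a i * u i w, fun w => ∑ j, b j * v j w; ν] := by
  rw [covariance_fun_sum_fun_sum (fun i => (hu i).const_mul (a i))
    (fun j => (hv j).const_mul (b j))]
  simp only [dotProduct, mulVec, covMatrix, of_apply, Finset.mul_sum]
  refine Finset.sum_congr rfl fun i _ => Finset.sum_congr rfl fun j _ => ?_
  rw [covariance_const_mul_left, covariance_const_mul_right, covariance_eq_sub (hu i) (hv j)]
  simp only [Pi.mul_apply]
  ring

theorem dotProduct_covMatrix_mulVec_self [IsProbabilityMeasure ν] (hu : ∀ i, MemLp (u i) 2 ν)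
    (a : Fin p → ℝ) :
    a ⬝ᵥ (covMatrix (fun g => ∫ w, g w ∂ν) u u *ᵥ a) = Var[fun w => ∑ i, a i * u i w; ν] := by
  rw [dotProduct_covMatrix_mulVec hu hu, covariance_self (memLp_sum_mul hu a).aemeasurable]

/-- The largest canonical correlation between two families of functions under `ν`. -/
def corrSup (ν : Measure (𝒳 × 𝒴)) (u : Fin p → 𝒳 × 𝒴 → ℝ) (v : Fin q → 𝒳 × 𝒴 → ℝ) : ℝ :=
  maxCorr (covMatrix (fun g => ∫ w, g w ∂ν) u u) (covMatrix (fun g => ∫ w, g w ∂ν) v v)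
    (covMatrix (fun g => ∫ w, g w ∂ν) u v)

/-- Cauchy–Schwarz with unit variances. It also supplies the upper bound without which the supremum
would be a default value. -/
theorem le_one_of_cov [IsProbabilityMeasure ν] (hu : ∀ i, MemLp (u i) 2 ν)
    (hv : ∀ j, MemLp (v j) 2 ν) {t : ℝ} (ht : ∃ (a : Fin p → ℝ) (b : Fin q → ℝ),
      a ⬝ᵥ (covMatrix (fun g => ∫ w, g w ∂ν) u u *ᵥ a) = 1 ∧
      b ⬝ᵥ (covMatrix (fun g => ∫ w, g w ∂ν) v v *ᵥ b) = 1 ∧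
      t = a ⬝ᵥ (covMatrix (fun g => ∫ w, g w ∂ν) u v *ᵥ b)) : t ≤ 1 := by
  obtain ⟨a, b, ha, hb, rfl⟩ := ht
  rw [dotProduct_covMatrix_mulVec_self hu] at ha
  rw [dotProduct_covMatrix_mulVec_self hv] at hb
  rw [dotProduct_covMatrix_mulVec hu hv]
  refine (le_abs_self _).trans ((abs_covariance_le (memLp_sum_mul hu a) (memLp_sum_mul hv b)).trans ?_)
  rw [ha, hb]; simp

theorem corrSup_le_one [IsProbabilityMeasure ν] (hu : ∀ i, MemLp (u i) 2 ν)
    (hv : ∀ j, MemLp (v j) 2 ν) : corrSup ν u v ≤ 1 :=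
  Real.sSup_le (fun _ ht => le_one_of_cov hu hv ht) zero_le_one

theorem le_corrSup [IsProbabilityMeasure ν] (hu : ∀ i, MemLp (u i) 2 ν)
    (hv : ∀ j, MemLp (v j) 2 ν) {a : Fin p → ℝ} {b : Fin q → ℝ}
    (ha : Var[fun w => ∑ i, a i * u i w; ν] = 1) (hb : Var[fun w => ∑ j, b j * v j w; ν] = 1) :
    cov[fun w => ∑ i, a i * u i w, fun w => ∑ j, b j * v j w; ν] ≤ corrSup ν u v := by
  refine le_csSup ⟨1, fun t ht => le_one_of_cov hu hv ht⟩ ⟨a, b, ?_, ?_, ?_⟩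
  · rw [dotProduct_covMatrix_mulVec_self hu, ha]
  · rw [dotProduct_covMatrix_mulVec_self hv, hb]
  · rw [dotProduct_covMatrix_mulVec hu hv]

/-- The constraint set is invariant under a ↦ -a, which flips the sign of the covariance. -/
theorem abs_le_corrSup [IsProbabilityMeasure ν] (hu : ∀ i, MemLp (u i) 2 ν)
    (hv : ∀ j, MemLp (v j) 2 ν) {a : Fin p → ℝ} {b : Fin q → ℝ}
    (ha : Var[fun w => ∑ i, a i * u i w; ν] = 1) (hb : Var[fun w => ∑ j, b j * v j w; ν] = 1) :
    |cov[fun w => ∑ i, a i * u i w, fun w => ∑ j, b j * v j w; ν]| ≤ corrSup ν u v := by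
  refine abs_le'.2 ⟨le_corrSup hu hv ha hb, ?_⟩
  have h : (fun w => ∑ i, (-a) i * u i w) = fun w => -∑ i, a i * u i w := by
    ext w; simp
  rw [← covariance_fun_neg_left, ← h]
  refine le_corrSup hu hv ?_ hb
  rw [h, variance_fun_neg, ha]

theorem corrSup_nonneg [IsProbabilityMeasure ν] (hu : ∀ i, MemLp (u i) 2 ν)
    (hv : ∀ j, MemLp (v j) 2 ν) : 0 ≤ corrSup ν u v := by
  by_cases h : ∃ (a : Fin p → ℝ) (b : Fin q → ℝ),
      Var[fun w => ∑ i, a i * u i w; ν] = 1 ∧ Var[fun w => ∑ j, b j * v j w; ν] = 1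
  · obtain ⟨a, b, ha, hb⟩ := h
    exact (abs_nonneg _).trans (abs_le_corrSup hu hv ha hb)
  -- With no admissible pair the supremum is over the empty set, hence 0.
  · refine Real.sSup_nonneg fun t ⟨a, b, ha, hb, _⟩ => (h ⟨a, b, ?_, ?_⟩).elim
    · rw [← dotProduct_covMatrix_mulVec_self hu, ha]
    · rw [← dotProduct_covMatrix_mulVec_self hv, hb]

/-- Homogeneity: normalise both combinations to unit variance. If a variance vanishes,
Cauchy–Schwarz makes the covariance vanish too. -/
theorem abs_cov_le_corrSup_mul [IsProbabilityMeasure ν] (hu : ∀ i, MemLp (u i) 2 ν)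
    (hv : ∀ j, MemLp (v j) 2 ν) (a : Fin p → ℝ) (b : Fin q → ℝ) :
    |cov[fun w => ∑ i, a i * u i w, fun w => ∑ j, b j * v j w; ν]| ≤
      corrSup ν u v * (√Var[fun w => ∑ i, a i * u i w; ν] *
        √Var[fun w => ∑ j, b j * v j w; ν]) := by
  set U := fun w => ∑ i, a i * u i w with hU
  set V := fun w => ∑ j, b j * v j w with hV
  have hcs := abs_covariance_le (memLp_sum_mul hu a) (memLp_sum_mul hv b)
  rcases (Real.sqrt_nonneg Var[U; ν]).eq_or_lt' with hs | hs
  · rw [hs] at hcs ⊢; simpa using hcs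
  rcases (Real.sqrt_nonneg Var[V; ν]).eq_or_lt' with ht | ht
  · rw [ht] at hcs ⊢; simpa using hcs
  have e1 : (fun w => ∑ i, ((√Var[U; ν])⁻¹ • a) i * u i w) = fun w => (√Var[U; ν])⁻¹ * U w := by
    ext w; simp [hU, Finset.mul_sum, mul_assoc]
  have e2 : (fun w => ∑ i, ((√Var[V; ν])⁻¹ • b) i * v i w) = fun w => (√Var[V; ν])⁻¹ * V w := by
    ext w; simp [hV, Finset.mul_sum, mul_assoc]
  have h := abs_le_corrSup hu hv (a := (√Var[U; ν])⁻¹ • a) (b := (√Var[V; ν])⁻¹ • b) ?_ ?_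
  · rw [e1, e2, covariance_const_mul_left, covariance_const_mul_right, abs_mul, abs_mul,
      abs_of_pos (inv_pos.2 hs), abs_of_pos (inv_pos.2 ht)] at h
    calc |cov[U, V; ν]| = ((√Var[U; ν])⁻¹ * ((√Var[V; ν])⁻¹ * |cov[U, V; ν]|)) *
          (√Var[U; ν] * √Var[V; ν]) := by field_simp
      _ ≤ _ := by gcongr
  · rw [e1, variance_const_mul, inv_pow, Real.sq_sqrt (variance_nonneg _ _),
      inv_mul_cancel₀ (Real.sqrt_pos.1 hs).ne']
  · rw [e2, variance_const_mul, inv_pow, Real.sq_sqrt (variance_nonneg _ _),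
      inv_mul_cancel₀ (Real.sqrt_pos.1 ht).ne']

/-- The correlation bound with uncentered second moments. -/
theorem abs_cov_le_corrSup_mul_sq [IsProbabilityMeasure ν] (hu : ∀ i, MemLp (u i) 2 ν)
    (hv : ∀ j, MemLp (v j) 2 ν) (a : Fin p → ℝ) (b : Fin q → ℝ) :
    |cov[fun w => ∑ i, a i * u i w, fun w => ∑ j, b j * v j w; ν]| ≤
      corrSup ν u v * (√(∫ w, (∑ i, a i * u i w) ^ 2 ∂ν) * √(∫ w, (∑ j, b j * v j w) ^ 2 ∂ν)) := by
  refine (abs_cov_le_corrSup_mul hu hv a b).trans ?_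
  have h1 := variance_le_expectation_sq (memLp_sum_mul hu a).aestronglyMeasurable
  have h2 := variance_le_expectation_sq (memLp_sum_mul hv b).aestronglyMeasurable
  have := corrSup_nonneg hu hv
  gcongr
  · exact h1
  · exact h2

/-- If `1` lies in the span of both families, bounding the covariance by uncentered second
moments bounds the correlation. -/
theorem corrSup_le_of_forall [IsProbabilityMeasure ν] (hu : ∀ i, MemLp (u i) 2 ν)
    (hv : ∀ j, MemLp (v j) 2 ν) (hu1 : ∃ a : Fin p → ℝ, ∀ w, ∑ i, a i * u i w = 1)
    (hv1 : ∃ b : Fin q → ℝ, ∀ w, ∑ j, b j * v j w = 1) {c : ℝ} (hc : 0 ≤ c)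
    (h : ∀ (a : Fin p → ℝ) (b : Fin q → ℝ),
      |cov[fun w => ∑ i, a i * u i w, fun w => ∑ j, b j * v j w; ν]| ≤
      c * (√(∫ w, (∑ i, a i * u i w) ^ 2 ∂ν) * √(∫ w, (∑ j, b j * v j w) ^ 2 ∂ν))) :
    corrSup ν u v ≤ c := by
  refine Real.sSup_le (fun t ⟨a, b, ha, hb, ht⟩ => ?_) hc
  obtain ⟨a₀, ha₀⟩ := hu1
  obtain ⟨b₀, hb₀⟩ := hv1
  rw [dotProduct_covMatrix_mulVec_self hu] at ha
  rw [dotProduct_covMatrix_mulVec_self hv] at hb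
  rw [ht, dotProduct_covMatrix_mulVec hu hv]
  have hU := memLp_sum_mul hu a
  have hV := memLp_sum_mul hv b
  set U := fun w => ∑ i, a i * u i w with hUdef
  set V := fun w => ∑ j, b j * v j w with hVdef
  -- Subtracting the mean stays in the span. It leaves the covariance unchanged and turns the
  -- uncentered second moment into the variance, which is 1.
  have e1 : (fun w => ∑ i, (a - ν[U] • a₀) i * u i w) = fun w => U w - ν[U] := by
    ext w
    simp only [Pi.sub_apply, Pi.smul_apply, smul_eq_mul, sub_mul, Finset.sum_sub_distrib, mul_assoc,
      ← Finset.mul_sum, ha₀, mul_one, hUdef]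
  have e2 : (fun w => ∑ j, (b - ν[V] • b₀) j * v j w) = fun w => V w - ν[V] := by
    ext w
    simp only [Pi.sub_apply, Pi.smul_apply, smul_eq_mul, sub_mul, Finset.sum_sub_distrib, mul_assoc,
      ← Finset.mul_sum, hb₀, mul_one, hVdef]
  have key := h (a - ν[U] • a₀) (b - ν[V] • b₀)
  have f1 : ∀ w, ∑ i, (a - ν[U] • a₀) i * u i w = U w - ν[U] := fun w => congrFun e1 w
  have f2 : ∀ w, ∑ j, (b - ν[V] • b₀) j * v j w = V w - ν[V] := fun w => congrFun e2 w
  simp only [f1, f2] at key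
  rw [covariance_sub_const_left (hU.integrable one_le_two),
    covariance_sub_const_right (hV.integrable one_le_two),
    ← variance_eq_integral hU.aemeasurable, ← variance_eq_integral hV.aemeasurable, ha, hb] at key
  simpa using (le_abs_self _).trans key

end Correlation

/-! ### Stability of the correlation under perturbed moments -/

section Perturbation

variable {𝒳 𝒴 : Type*} [MeasurableSpace 𝒳] [MeasurableSpace 𝒴] {ν ν' : Measure (𝒳 × 𝒴)}
  {p q : ℕ} {u : Fin p → 𝒳 × 𝒴 → ℝ} {v : Fin q → 𝒳 × 𝒴 → ℝ}

theorem integral_sq_sum_mul [IsFiniteMeasure ν] (hu : ∀ i, MemLp (u i) 2 ν) (a : Fin p → ℝ) :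
    ∫ w, (∑ i, a i * u i w) ^ 2 ∂ν = ∑ i, ∑ j, a i * a j * ∫ w, u i w * u j w ∂ν := by
  have hint : ∀ i j, Integrable (fun w => a i * a j * (u i w * u j w)) ν := fun i j =>
    ((hu i).integrable_mul (hu j)).const_mul _
  have e : ∀ w, (∑ i, a i * u i w) ^ 2 = ∑ i, ∑ j, a i * a j * (u i w * u j w) := by
    intro w
    rw [sq, Finset.sum_mul_sum]
    exact Finset.sum_congr rfl fun i _ => Finset.sum_congr rfl fun j _ => by ring
  simp_rw [e]
  rw [integral_finsetSum _ fun i _ => integrable_finsetSum _ fun j _ => hint i j]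
  refine Finset.sum_congr rfl fun i _ => ?_
  rw [integral_finsetSum _ fun j _ => hint i j]
  exact Finset.sum_congr rfl fun j _ => integral_const_mul _ _

theorem covariance_sum_mul [IsProbabilityMeasure ν] (hu : ∀ i, MemLp (u i) 2 ν)
    (hv : ∀ j, MemLp (v j) 2 ν) (a : Fin p → ℝ) (b : Fin q → ℝ) :
    cov[fun w => ∑ i, a i * u i w, fun w => ∑ j, b j * v j w; ν] =
      ∑ i, ∑ j, a i * b j * (∫ w, u i w * v j w ∂ν - (∫ w, u i w ∂ν) * ∫ w, v j w ∂ν) := by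
  rw [← dotProduct_covMatrix_mulVec hu hv]
  simp only [dotProduct, mulVec, covMatrix, of_apply, Finset.mul_sum]
  exact Finset.sum_congr rfl fun i _ => Finset.sum_congr rfl fun j _ => by ring

theorem abs_sum_sum_mul_le (a : Fin p → ℝ) (b : Fin q → ℝ) {c : Fin p → Fin q → ℝ} {C : ℝ}
    (hc : ∀ i j, |c i j| ≤ C) :
    |∑ i, ∑ j, a i * b j * c i j| ≤ C * ((∑ i, |a i|) * ∑ j, |b j|) := by
  rw [Finset.sum_mul_sum, Finset.mul_sum]
  refine (Finset.abs_sum_le_sum_abs _ _).trans (Finset.sum_le_sum fun i _ => ?_)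
  rw [Finset.mul_sum]
  refine (Finset.abs_sum_le_sum_abs _ _).trans (Finset.sum_le_sum fun j _ => ?_)
  rw [abs_mul, abs_mul, mul_comm]
  have := hc i j
  gcongr

/-- Cauchy–Schwarz costs a factor p in passing from the ℓ¹ to the ℓ² norm; the eigenvalue bound then
compares ℓ² with the second moment `A` of the combination. -/
theorem sum_abs_le_sqrt {κ δ A : ℝ} (a : Fin p → ℝ) (hδ : 0 < δ) (hA : δ * ∑ i, a i ^ 2 ≤ A)
    (hκ : (p : ℝ) / δ ≤ κ) : ∑ i, |a i| ≤ √κ * √A := by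
  have hs : 0 ≤ ∑ i, a i ^ 2 := Finset.sum_nonneg fun i _ => sq_nonneg _
  have hA0 : 0 ≤ A := (mul_nonneg hδ.le hs).trans hA
  have hκ0 : 0 ≤ κ := le_trans (by positivity) hκ
  rw [← Real.sqrt_mul hκ0]
  refine Real.le_sqrt_of_sq_le ?_
  have h1 := sq_sum_le_card_mul_sum_sq (s := Finset.univ) (f := fun i => |a i|)
  simp only [sq_abs, Finset.card_univ, Fintype.card_fin] at h1
  calc (∑ i, |a i|) ^ 2 ≤ p * ∑ i, a i ^ 2 := h1
    _ = (p / δ) * (δ * ∑ i, a i ^ 2) := by field_simp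
    _ ≤ κ * A := by gcongr

theorem abs_integral_le_one [IsProbabilityMeasure ν] {g : 𝒳 × 𝒴 → ℝ} (hg : ∀ w, |g w| ≤ 1) :
    |∫ w, g w ∂ν| ≤ 1 := by
  simpa using norm_integral_le_of_norm_le_const (μ := ν) (C := 1) (f := g)
    (ae_of_all _ fun w => by simpa using hg w)

/-- The correlation is Lipschitz in the moments, with constant governed by the smallest eigenvalue
of the uncentered second moment matrices. -/
theorem abs_corrSup_sub_corrSup_le [IsProbabilityMeasure ν] [IsProbabilityMeasure ν']
    (hum : ∀ i, Measurable (u i)) (hvm : ∀ j, Measurable (v j)) (hub : ∀ i w, |u i w| ≤ 1)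
    (hvb : ∀ j w, |v j w| ≤ 1)
    (hu1 : ∃ a : Fin p → ℝ, ∀ w, ∑ i, a i * u i w = 1)
    (hv1 : ∃ b : Fin q → ℝ, ∀ w, ∑ j, b j * v j w = 1) {δ η : ℝ} (hδ : 0 < δ) (hη : 0 ≤ η)
    (hδu : ∀ a : Fin p → ℝ, δ * ∑ i, a i ^ 2 ≤ ∫ w, (∑ i, a i * u i w) ^ 2 ∂ν)
    (hδv : ∀ b : Fin q → ℝ, δ * ∑ j, b j ^ 2 ≤ ∫ w, (∑ j, b j * v j w) ^ 2 ∂ν)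
    (huu : ∀ i j, |∫ w, u i w * u j w ∂ν' - ∫ w, u i w * u j w ∂ν| ≤ η)
    (hvv : ∀ i j, |∫ w, v i w * v j w ∂ν' - ∫ w, v i w * v j w ∂ν| ≤ η)
    (huv : ∀ i j, |∫ w, u i w * v j w ∂ν' - ∫ w, u i w * v j w ∂ν| ≤ η)
    (hu0 : ∀ i, |∫ w, u i w ∂ν' - ∫ w, u i w ∂ν| ≤ η)
    (hv0 : ∀ j, |∫ w, v j w ∂ν' - ∫ w, v j w ∂ν| ≤ η) :
    |corrSup ν' u v - corrSup ν u v| ≤ 8 * (((p : ℝ) + q) / δ * η) := by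
  have hu := fun i => memLp_two_of_abs_le_one (ν := ν) (hum i) (hub i)
  have hv := fun j => memLp_two_of_abs_le_one (ν := ν) (hvm j) (hvb j)
  have hu' := fun i => memLp_two_of_abs_le_one (ν := ν') (hum i) (hub i)
  have hv' := fun j => memLp_two_of_abs_le_one (ν := ν') (hvm j) (hvb j)
  set κ := ((p : ℝ) + q) / δ with hκ
  set τ := κ * η with hτ
  have hκ0 : 0 ≤ κ := by positivity
  have hτ0 : 0 ≤ τ := by positivity
  have hρ0 := corrSup_nonneg hu hv
  have hρ1 := corrSup_le_one hu hv
  have hρ0' := corrSup_nonneg hu' hv'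
  have hρ1' := corrSup_le_one hu' hv'
  set ρ := corrSup ν u v
  set ρ' := corrSup ν' u v
  -- For τ ≥ 1/2 the right side is at least 4, while both correlations lie in [0,1]. Otherwise 1 - τ
  -- is bounded away from 0.
  rcases le_total (1 / 2) τ with hτ2 | hτ2
  · exact abs_le.2 ⟨by linarith, by linarith⟩
  have su : ∀ a : Fin p → ℝ, ∑ i, |a i| ≤ √κ * √(∫ w, (∑ i, a i * u i w) ^ 2 ∂ν) := fun a =>
    sum_abs_le_sqrt a hδ (hδu a) (by rw [hκ]; gcongr; simp)
  have sv : ∀ b : Fin q → ℝ, ∑ j, |b j| ≤ √κ * √(∫ w, (∑ j, b j * v j w) ^ 2 ∂ν) := fun b =>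
    sum_abs_le_sqrt b hδ (hδv b) (by rw [hκ]; gcongr; simp)
  -- The error is relative: the coefficient norm is paid for by the second moment itself, at the
  -- price κ.
  have qu : ∀ a : Fin p → ℝ, |∫ w, (∑ i, a i * u i w) ^ 2 ∂ν' - ∫ w, (∑ i, a i * u i w) ^ 2 ∂ν| ≤
      τ * ∫ w, (∑ i, a i * u i w) ^ 2 ∂ν := by
    intro a
    have h0 : 0 ≤ ∫ w, (∑ i, a i * u i w) ^ 2 ∂ν := integral_nonneg fun w => sq_nonneg _
    have hs := su a
    calc _ = |∑ i, ∑ j, a i * a j * (∫ w, u i w * u j w ∂ν' - ∫ w, u i w * u j w ∂ν)| := by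
          rw [integral_sq_sum_mul hu, integral_sq_sum_mul hu']
          simp only [mul_sub, Finset.sum_sub_distrib]
      _ ≤ η * ((∑ i, |a i|) * ∑ i, |a i|) := abs_sum_sum_mul_le a a huu
      _ ≤ η * ((√κ * √(∫ w, (∑ i, a i * u i w) ^ 2 ∂ν)) *
          (√κ * √(∫ w, (∑ i, a i * u i w) ^ 2 ∂ν))) := by gcongr
      _ = η * ((√κ * √κ) * (√(∫ w, (∑ i, a i * u i w) ^ 2 ∂ν) *
          √(∫ w, (∑ i, a i * u i w) ^ 2 ∂ν))) := by ring
      _ = _ := by rw [Real.mul_self_sqrt hκ0, Real.mul_self_sqrt h0, hτ]; ring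
  have qv : ∀ b : Fin q → ℝ, |∫ w, (∑ j, b j * v j w) ^ 2 ∂ν' - ∫ w, (∑ j, b j * v j w) ^ 2 ∂ν| ≤
      τ * ∫ w, (∑ j, b j * v j w) ^ 2 ∂ν := by
    intro a
    have h0 : 0 ≤ ∫ w, (∑ i, a i * v i w) ^ 2 ∂ν := integral_nonneg fun w => sq_nonneg _
    have hs := sv a
    calc _ = |∑ i, ∑ j, a i * a j * (∫ w, v i w * v j w ∂ν' - ∫ w, v i w * v j w ∂ν)| := by
          rw [integral_sq_sum_mul hv, integral_sq_sum_mul hv']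
          simp only [mul_sub, Finset.sum_sub_distrib]
      _ ≤ η * ((∑ i, |a i|) * ∑ i, |a i|) := abs_sum_sum_mul_le a a hvv
      _ ≤ η * ((√κ * √(∫ w, (∑ i, a i * v i w) ^ 2 ∂ν)) *
          (√κ * √(∫ w, (∑ i, a i * v i w) ^ 2 ∂ν))) := by gcongr
      _ = η * ((√κ * √κ) * (√(∫ w, (∑ i, a i * v i w) ^ 2 ∂ν) *
          √(∫ w, (∑ i, a i * v i w) ^ 2 ∂ν))) := by ring
      _ = _ := by rw [Real.mul_self_sqrt hκ0, Real.mul_self_sqrt h0, hτ]; ring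
  -- One error from the mixed moment and two from the product of means, the means being bounded by
  -- 1.
  have hentry : ∀ i j, |(∫ w, u i w * v j w ∂ν' - (∫ w, u i w ∂ν') * ∫ w, v j w ∂ν') -
      (∫ w, u i w * v j w ∂ν - (∫ w, u i w ∂ν) * ∫ w, v j w ∂ν)| ≤ 3 * η := by
    intro i j
    have e : (∫ w, u i w * v j w ∂ν' - (∫ w, u i w ∂ν') * ∫ w, v j w ∂ν') -
      (∫ w, u i w * v j w ∂ν - (∫ w, u i w ∂ν) * ∫ w, v j w ∂ν) =
      (∫ w, u i w * v j w ∂ν' - ∫ w, u i w * v j w ∂ν) -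
      ((∫ w, u i w ∂ν' - ∫ w, u i w ∂ν) * (∫ w, v j w ∂ν') +
       (∫ w, u i w ∂ν) * (∫ w, v j w ∂ν' - ∫ w, v j w ∂ν)) := by ring
    have h1 : |(∫ w, u i w ∂ν' - ∫ w, u i w ∂ν) * (∫ w, v j w ∂ν')| ≤ η * 1 := by
      rw [abs_mul]; exact mul_le_mul (hu0 i) (abs_integral_le_one (hvb j)) (abs_nonneg _) hη
    have h2 : |(∫ w, u i w ∂ν) * (∫ w, v j w ∂ν' - ∫ w, v j w ∂ν)| ≤ 1 * η := by
      rw [abs_mul]; exact mul_le_mul (abs_integral_le_one (hub i)) (hv0 j) (abs_nonneg _) zero_le_one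
    rw [e]
    refine (abs_sub _ _).trans ?_
    have := abs_add_le ((∫ w, u i w ∂ν' - ∫ w, u i w ∂ν) * (∫ w, v j w ∂ν'))
      ((∫ w, u i w ∂ν) * (∫ w, v j w ∂ν' - ∫ w, v j w ∂ν))
    linarith [huv i j]
  have qc : ∀ (a : Fin p → ℝ) (b : Fin q → ℝ),
      |cov[fun w => ∑ i, a i * u i w, fun w => ∑ j, b j * v j w; ν'] -
        cov[fun w => ∑ i, a i * u i w, fun w => ∑ j, b j * v j w; ν]| ≤
      3 * τ * (√(∫ w, (∑ i, a i * u i w) ^ 2 ∂ν) * √(∫ w, (∑ j, b j * v j w) ^ 2 ∂ν)) := by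
    intro a b
    have hs := su a
    have hs' := sv b
    calc _ = |∑ i, ∑ j, a i * b j * ((∫ w, u i w * v j w ∂ν' - (∫ w, u i w ∂ν') * ∫ w, v j w ∂ν') -
          (∫ w, u i w * v j w ∂ν - (∫ w, u i w ∂ν) * ∫ w, v j w ∂ν))| := by
          rw [covariance_sum_mul hu hv, covariance_sum_mul hu' hv']
          simp only [mul_sub, Finset.sum_sub_distrib]
      _ ≤ 3 * η * ((∑ i, |a i|) * ∑ j, |b j|) := abs_sum_sum_mul_le a b hentry
      _ ≤ 3 * η * ((√κ * √(∫ w, (∑ i, a i * u i w) ^ 2 ∂ν)) *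
          (√κ * √(∫ w, (∑ j, b j * v j w) ^ 2 ∂ν))) := by gcongr
      _ = 3 * η * ((√κ * √κ) * (√(∫ w, (∑ i, a i * u i w) ^ 2 ∂ν) *
          √(∫ w, (∑ j, b j * v j w) ^ 2 ∂ν))) := by ring
      _ = _ := by rw [Real.mul_self_sqrt hκ0, hτ]; ring
  -- Under `ν'` the covariance is at most (ρ + 3τ)√A√B, and the norms under `ν` are replaced by
  -- those under `ν'` through (1 - τ)A ≤ A', and likewise for B.
  have h1 : ρ' ≤ (ρ + 3 * τ) / (1 - τ) := by
    refine corrSup_le_of_forall hu' hv' hu1 hv1 (div_nonneg (by linarith) (by linarith))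
      fun a b => ?_
    have hA := (abs_le.1 (qu a)).1
    have hB := (abs_le.1 (qv b)).1
    have hc := abs_cov_le_corrSup_mul_sq hu hv a b
    have hd := qc a b
    set A := ∫ w, (∑ i, a i * u i w) ^ 2 ∂ν
    set B := ∫ w, (∑ j, b j * v j w) ^ 2 ∂ν
    set A' := ∫ w, (∑ i, a i * u i w) ^ 2 ∂ν'
    set B' := ∫ w, (∑ j, b j * v j w) ^ 2 ∂ν'
    have hAB : (1 - τ) * (√A * √B) ≤ √A' * √B' := by
      calc (1 - τ) * (√A * √B) = (√(1 - τ) * √(1 - τ)) * (√A * √B) := by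
            rw [Real.mul_self_sqrt (by linarith)]
        _ = (√(1 - τ) * √A) * (√(1 - τ) * √B) := by ring
        _ = √((1 - τ) * A) * √((1 - τ) * B) := by
            rw [Real.sqrt_mul (by linarith), Real.sqrt_mul (by linarith)]
        _ ≤ _ := by
            gcongr
            · linarith
            · linarith
    have hlast : (ρ + 3 * τ) * (√A * √B) ≤ (ρ + 3 * τ) / (1 - τ) * (√A' * √B') := by
      have h1τ : 0 < 1 - τ := by linarith
      calc (ρ + 3 * τ) * (√A * √B) = (ρ + 3 * τ) / (1 - τ) * ((1 - τ) * (√A * √B)) := by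
            field_simp
        _ ≤ _ := by gcongr
    refine le_trans ?_ hlast
    have := abs_sub_abs_le_abs_sub (cov[fun w => ∑ i, a i * u i w, fun w => ∑ j, b j * v j w; ν'])
      (cov[fun w => ∑ i, a i * u i w, fun w => ∑ j, b j * v j w; ν])
    change _ ≤ ρ * _ at hc
    rw [add_mul]
    linarith
  -- The same comparison in the other direction, now with A' ≤ (1 + τ)A.
  have h2 : ρ ≤ ρ' * (1 + τ) + 3 * τ := by
    refine corrSup_le_of_forall hu hv hu1 hv1 (by positivity) fun a b => ?_
    have hA := (abs_le.1 (qu a)).2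
    have hB := (abs_le.1 (qv b)).2
    have hc := abs_cov_le_corrSup_mul_sq hu' hv' a b
    have hd := qc a b
    set A := ∫ w, (∑ i, a i * u i w) ^ 2 ∂ν
    set B := ∫ w, (∑ j, b j * v j w) ^ 2 ∂ν
    set A' := ∫ w, (∑ i, a i * u i w) ^ 2 ∂ν'
    set B' := ∫ w, (∑ j, b j * v j w) ^ 2 ∂ν'
    have hAB : √A' * √B' ≤ (1 + τ) * (√A * √B) := by
      calc √A' * √B' ≤ √((1 + τ) * A) * √((1 + τ) * B) := by
            gcongr
            · linarith
            · linarith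
        _ = (√(1 + τ) * √A) * (√(1 + τ) * √B) := by
            rw [Real.sqrt_mul (by linarith), Real.sqrt_mul (by linarith)]
        _ = (√(1 + τ) * √(1 + τ)) * (√A * √B) := by ring
        _ = _ := by rw [Real.mul_self_sqrt (by linarith)]
    have := abs_sub_abs_le_abs_sub (cov[fun w => ∑ i, a i * u i w, fun w => ∑ j, b j * v j w; ν])
      (cov[fun w => ∑ i, a i * u i w, fun w => ∑ j, b j * v j w; ν'])
    rw [abs_sub_comm] at this
    change _ ≤ ρ' * _ at hc
    have h3 : ρ' * (√A' * √B') ≤ ρ' * ((1 + τ) * (√A * √B)) := by gcongr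
    rw [add_mul, mul_assoc]
    linarith
  rw [le_div_iff₀ (by linarith)] at h1
  -- Since ρ' ≤ 1, each direction loses at most 4τ; the constant 8 is not sharp.
  refine abs_le.2 ⟨?_, ?_⟩
  · nlinarith
  · nlinarith [mul_nonneg hτ0 (sub_nonneg.2 hρ1')]

end Perturbation

/-! ### Conditional means and kernel estimators as integrals -/

section MomentFunctional

/-- Division by zero turns the kernel estimator into the zero functional when its denominator
vanishes; the constraints are then unsatisfiable, which matches the convention for the estimated
correlation. -/
theorem maxBasisCorr_zero {𝒳 𝒴 : Type*} {p q : ℕ} (φ : Fin p → 𝒳 → ℝ) (ψ : Fin q → 𝒴 → ℝ) :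
    maxBasisCorr (fun _ => 0) φ ψ = 0 := by
  unfold maxBasisCorr maxCorr
  convert Real.sSup_empty
  refine Set.eq_empty_of_forall_notMem fun t ⟨a, b, ha, _⟩ => ?_
  have : covMatrix (fun _ => 0) (fun i (w : 𝒳 × 𝒴) => φ i w.1) (fun i w => φ i w.1) = 0 := by
    ext; simp [covMatrix]
  rw [this] at ha
  simp at ha

variable {𝒳 𝒴 : Type*} [MeasurableSpace 𝒳] [MeasurableSpace 𝒴]

/-- Agreement on measurable functions is all that is asked, because the integral formula for the
kernel estimator is established only for these. -/
theorem maxBasisCorr_eq_corrSup {E : (𝒳 × 𝒴 → ℝ) → ℝ} {ν : Measure (𝒳 × 𝒴)}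
    (hE : ∀ g, Measurable g → E g = ∫ w, g w ∂ν) {p q : ℕ} {φ : Fin p → 𝒳 → ℝ}
    {ψ : Fin q → 𝒴 → ℝ} (hφ : ∀ i, Measurable (φ i)) (hψ : ∀ j, Measurable (ψ j)) :
    maxBasisCorr E φ ψ = corrSup ν (fun i w => φ i w.1) (fun j w => ψ j w.2) := by
  have hu : ∀ i, Measurable fun w : 𝒳 × 𝒴 => φ i w.1 := fun i => (hφ i).comp measurable_fst
  have hv : ∀ j, Measurable fun w : 𝒳 × 𝒴 => ψ j w.2 := fun j => (hψ j).comp measurable_snd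
  unfold maxBasisCorr corrSup
  congr 1 <;> ext i j <;> simp only [covMatrix, of_apply]
  · rw [hE (fun w => φ i w.1 * φ j w.1) ((hu i).mul (hu j)), hE _ (hu i), hE _ (hu j)]
  · rw [hE (fun w => ψ i w.2 * ψ j w.2) ((hv i).mul (hv j)), hE _ (hv i), hE _ (hv j)]
  · rw [hE (fun w => φ i w.1 * ψ j w.2) ((hu i).mul (hv j)), hE _ (hu i), hE _ (hv j)]

theorem condMean_eq_integral {d : ℕ} {μ : Measure (𝒳 × 𝒴)}
    {f : 𝒳 × 𝒴 → EuclideanSpace ℝ (Fin d) → ℝ} {z : EuclideanSpace ℝ (Fin d)}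
    (hf : Measurable (Function.uncurry f)) (h0 : ∀ w, 0 ≤ f w z) (g : 𝒳 × 𝒴 → ℝ) :
    condMean μ f z g = ∫ w, g w ∂μ.withDensity fun w => ENNReal.ofReal (f w z) := by
  have hm : Measurable fun w => f w z := hf.comp measurable_prodMk_right
  rw [integral_withDensity_eq_integral_toReal_smul hm.ennreal_ofReal
    (ae_of_all _ fun _ => ENNReal.ofReal_lt_top)]
  simp only [condMean, ENNReal.toReal_ofReal (h0 _), smul_eq_mul, mul_comm]

/-- The weighted empirical measure behind the kernel estimator. -/
def kernelMeasure {d : ℕ} (k₀ : EuclideanSpace ℝ (Fin d) → ℝ) (n : ℕ) (h : ℝ)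
    (x : ℕ → 𝒳) (y : ℕ → 𝒴) (z' : ℕ → EuclideanSpace ℝ (Fin d))
    (z : EuclideanSpace ℝ (Fin d)) : Measure (𝒳 × 𝒴) :=
  ∑ i ∈ Finset.range n, ENNReal.ofReal (scaledKernel k₀ h (z - z' i) /
    ∑ i ∈ Finset.range n, scaledKernel k₀ h (z - z' i)) • Measure.dirac (x i, y i)

variable {d : ℕ} {k₀ : EuclideanSpace ℝ (Fin d) → ℝ} {n : ℕ} {h : ℝ} {x : ℕ → 𝒳} {y : ℕ → 𝒴}
  {z' : ℕ → EuclideanSpace ℝ (Fin d)} {z : EuclideanSpace ℝ (Fin d)}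

theorem scaledKernel_nonneg (hk : ∀ u, 0 ≤ k₀ u) (hh : 0 < h) (u : EuclideanSpace ℝ (Fin d)) :
    0 ≤ scaledKernel k₀ h u :=
  mul_nonneg (by positivity) (hk _)

theorem isProbabilityMeasure_kernelMeasure (hk : ∀ u, 0 ≤ k₀ u) (hh : 0 < h)
    (hD : ∑ i ∈ Finset.range n, scaledKernel k₀ h (z - z' i) ≠ 0) :
    IsProbabilityMeasure (kernelMeasure k₀ n h x y z' z) := by
  constructor
  simp only [kernelMeasure, Measure.finsetSum_apply, Measure.smul_apply, measure_univ, smul_eq_mul,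
    mul_one]
  rw [← ENNReal.ofReal_sum_of_nonneg fun i _ => div_nonneg (scaledKernel_nonneg hk hh _)
    (Finset.sum_nonneg fun i _ => scaledKernel_nonneg hk hh _), ← Finset.sum_div, div_self hD,
    ENNReal.ofReal_one]

theorem kernelMean_eq_integral (hk : ∀ u, 0 ≤ k₀ u) (hh : 0 < h) {g : 𝒳 × 𝒴 → ℝ}
    (hg : Measurable g) :
    kernelMean k₀ n h x y z' z g = ∫ w, g w ∂kernelMeasure k₀ n h x y z' z := by
  have hint : ∀ c : 𝒳 × 𝒴, Integrable g (Measure.dirac c) := fun c =>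
    (integrable_const (g c)).congr (by
      refine (ae_dirac_iff (measurableSet_eq_fun measurable_const hg)).2 rfl)
  unfold kernelMeasure kernelMean
  rw [integral_finsetSum_measure fun i _ => (hint _).smul_measure ENNReal.ofReal_ne_top,
    Finset.sum_div]
  refine Finset.sum_congr rfl fun i _ => ?_
  rw [integral_smul_measure, integral_dirac' _ _ hg.stronglyMeasurable,
    ENNReal.toReal_ofReal (div_nonneg (scaledKernel_nonneg hk hh _)
    (Finset.sum_nonneg fun i _ => scaledKernel_nonneg hk hh _)), smul_eq_mul]
  ring

end MomentFunctional

/-- The spectrum of A - δI is that of A shifted by δ, hence nonnegative, so A - δI is positive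
semidefinite. -/
theorem le_dotProduct_mulVec_of_spectrum {p : ℕ} {A : Matrix (Fin p) (Fin p) ℝ} (hA : A.IsHermitian)
    {δ : ℝ} (h : ∀ t ∈ spectrum ℝ A, δ ≤ t) (a : Fin p → ℝ) :
    δ * ∑ i, a i ^ 2 ≤ a ⬝ᵥ (A *ᵥ a) := by
  have hB : (A - algebraMap ℝ _ δ).IsHermitian := by
    refine hA.sub ?_
    rw [Algebra.algebraMap_eq_smul_one]
    simp [IsHermitian]
  have hpos : (A - algebraMap ℝ _ δ).PosSemidef := by
    rw [hB.posSemidef_iff_eigenvalues_nonneg]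
    intro i
    have hi := hB.eigenvalues_mem_spectrum_real i
    rw [← spectrum.sub_singleton_eq] at hi
    obtain ⟨t, ht, _, rfl, hts⟩ := hi
    have := h t ht
    simp only [Pi.zero_apply]
    rw [← hts]
    simpa using this
  have := hpos.dotProduct_mulVec_nonneg a
  rw [Algebra.algebraMap_eq_smul_one, sub_mulVec, smul_mulVec, one_mulVec, dotProduct_sub,
    dotProduct_smul] at this
  simp only [star_trivial, smul_eq_mul] at this
  have e : ∑ i, a i ^ 2 = a ⬝ᵥ a := by simp [dotProduct, sq]
  rw [e]
  linarith

/-! ### From errors of kernel averages to the error of the correlation -/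

section Pointwise

variable {𝒳 𝒴 : Type*}

/-- The functions `1`, `φ_i(x)` and `ψ_j(y)`. -/
def basisFun {p q : ℕ} (φ : Fin p → 𝒳 → ℝ) (ψ : Fin q → 𝒴 → ℝ) :
    Option (Fin p ⊕ Fin q) → 𝒳 × 𝒴 → ℝ
  | none, _ => 1
  | some (Sum.inl i), w => φ i w.1
  | some (Sum.inr j), w => ψ j w.2

theorem abs_basisFun_le {p q : ℕ} {φ : Fin p → 𝒳 → ℝ} {ψ : Fin q → 𝒴 → ℝ}
    (hφ : ∀ i x, |φ i x| ≤ 1) (hψ : ∀ j y, |ψ j y| ≤ 1) (s : Option (Fin p ⊕ Fin q))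
    (w : 𝒳 × 𝒴) : |basisFun φ ψ s w| ≤ 1 := by
  rcases s with _ | i | j
  · simp [basisFun]
  · exact hφ i _
  · exact hψ j _

theorem measurable_basisFun [MeasurableSpace 𝒳] [MeasurableSpace 𝒴] {p q : ℕ}
    {φ : Fin p → 𝒳 → ℝ} {ψ : Fin q → 𝒴 → ℝ} (hφ : ∀ i, Measurable (φ i))
    (hψ : ∀ j, Measurable (ψ j)) (s : Option (Fin p ⊕ Fin q)) : Measurable (basisFun φ ψ s) := by
  rcases s with _ | i | j
  · exact measurable_const
  · exact (hφ i).comp measurable_fst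
  · exact (hψ j).comp measurable_snd

/-- The kernel estimator of `E(g(X,Y) | Z = z) f_Z(z)`. -/
def kernelAvg {d : ℕ} (k₀ : EuclideanSpace ℝ (Fin d) → ℝ) (n : ℕ) (h : ℝ)
    (x : ℕ → 𝒳) (y : ℕ → 𝒴) (z' : ℕ → EuclideanSpace ℝ (Fin d))
    (z : EuclideanSpace ℝ (Fin d)) (g : 𝒳 × 𝒴 → ℝ) : ℝ :=
  (n : ℝ)⁻¹ * ∑ i ∈ Finset.range n, g (x i, y i) * scaledKernel k₀ h (z - z' i)

variable {d : ℕ} {k₀ : EuclideanSpace ℝ (Fin d) → ℝ} {n : ℕ} {h : ℝ} {x : ℕ → 𝒳} {y : ℕ → 𝒴}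
  {z' : ℕ → EuclideanSpace ℝ (Fin d)} {z : EuclideanSpace ℝ (Fin d)}

theorem kernelMean_eq_div (hn : n ≠ 0) (g : 𝒳 × 𝒴 → ℝ) :
    kernelMean k₀ n h x y z' z g =
      kernelAvg k₀ n h x y z' z g / kernelAvg k₀ n h x y z' z fun _ => 1 := by
  have : (n : ℝ)⁻¹ ≠ 0 := by positivity
  simp only [kernelMean, kernelAvg, one_mul]
  rw [mul_div_mul_left _ _ this]

theorem kernelDensity_eq_kernelAvg :
    kernelDensity k₀ n h z' z = kernelAvg k₀ n h x y z' z fun _ => 1 := by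
  simp only [kernelDensity, kernelAvg, scaledKernel, one_mul, ← Finset.mul_sum, mul_inv, mul_assoc]

variable [MeasurableSpace 𝒳] [MeasurableSpace 𝒴]

/-- Valid for every sample, including a vanishing denominator; this is what makes the large-error
cases trivial. -/
theorem maxBasisCorr_kernelMean_mem {p q : ℕ} {φ : Fin p → 𝒳 → ℝ} {ψ : Fin q → 𝒴 → ℝ}
    (hφ : ∀ i, Measurable (φ i)) (hψ : ∀ j, Measurable (ψ j)) (hφb : ∀ i x, |φ i x| ≤ 1)
    (hψb : ∀ j y, |ψ j y| ≤ 1) (hk : ∀ u, 0 ≤ k₀ u) (hh : 0 < h) :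
    0 ≤ maxBasisCorr (kernelMean k₀ n h x y z' z) φ ψ ∧
      maxBasisCorr (kernelMean k₀ n h x y z' z) φ ψ ≤ 1 := by
  by_cases hD : ∑ i ∈ Finset.range n, scaledKernel k₀ h (z - z' i) = 0
  · have : kernelMean k₀ n h x y z' z = fun _ => 0 := by
      ext g; simp [kernelMean, hD]
    rw [this, maxBasisCorr_zero]
    simp
  · have := isProbabilityMeasure_kernelMeasure (x := x) (y := y) hk hh hD
    rw [maxBasisCorr_eq_corrSup (fun g hg => kernelMean_eq_integral hk hh hg) hφ hψ]
    have hu := fun i => memLp_two_of_abs_le_one (ν := kernelMeasure k₀ n h x y z' z)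
      ((hφ i).comp measurable_fst) fun w => hφb i w.1
    have hv := fun j => memLp_two_of_abs_le_one (ν := kernelMeasure k₀ n h x y z' z)
      ((hψ j).comp measurable_snd) fun w => hψb j w.2
    exact ⟨corrSup_nonneg hu hv, corrSup_le_one hu hv⟩

theorem maxBasisCorr_mem {E : (𝒳 × 𝒴 → ℝ) → ℝ} {ν : Measure (𝒳 × 𝒴)} [IsProbabilityMeasure ν]
    (hE : ∀ g, E g = ∫ w, g w ∂ν) {p q : ℕ} {φ : Fin p → 𝒳 → ℝ} {ψ : Fin q → 𝒴 → ℝ}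
    (hφ : ∀ i, Measurable (φ i)) (hψ : ∀ j, Measurable (ψ j)) (hφb : ∀ i x, |φ i x| ≤ 1)
    (hψb : ∀ j y, |ψ j y| ≤ 1) : 0 ≤ maxBasisCorr E φ ψ ∧ maxBasisCorr E φ ψ ≤ 1 := by
  rw [maxBasisCorr_eq_corrSup (fun g _ => hE g) hφ hψ]
  have hu := fun i => memLp_two_of_abs_le_one (ν := ν)
    ((hφ i).comp measurable_fst) fun w => hφb i w.1
  have hv := fun j => memLp_two_of_abs_le_one (ν := ν)
    ((hψ j).comp measurable_snd) fun w => hψb j w.2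
  exact ⟨corrSup_nonneg hu hv, corrSup_le_one hu hv⟩

theorem le_integral_sq_of_spectrum {ν : Measure (𝒳 × 𝒴)} [IsProbabilityMeasure ν]
    {E : (𝒳 × 𝒴 → ℝ) → ℝ} (hE : ∀ g, E g = ∫ w, g w ∂ν) {p : ℕ} {u : Fin p → 𝒳 × 𝒴 → ℝ}
    (hu : ∀ i, MemLp (u i) 2 ν) {δ : ℝ}
    (h : ∀ t ∈ spectrum ℝ (secondMomentMatrix E u), δ ≤ t) (a : Fin p → ℝ) :
    δ * ∑ i, a i ^ 2 ≤ ∫ w, (∑ i, a i * u i w) ^ 2 ∂ν := by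
  have hA : (secondMomentMatrix E u).IsHermitian := by
    ext i j
    simp [secondMomentMatrix, mul_comm]
  refine (le_dotProduct_mulVec_of_spectrum hA h a).trans_eq ?_
  rw [integral_sq_sum_mul hu]
  simp only [dotProduct, mulVec, secondMomentMatrix, of_apply, Finset.mul_sum, hE]
  exact Finset.sum_congr rfl fun i _ => Finset.sum_congr rfl fun j _ => by ring

/-- The error of the estimated correlation is controlled by the errors of the kernel averages of
the products of basis functions. -/
theorem abs_maxBasisCorr_kernelMean_sub_le {ν : Measure (𝒳 × 𝒴)} [IsProbabilityMeasure ν]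
    {E : (𝒳 × 𝒴 → ℝ) → ℝ} (hE : ∀ g, E g = ∫ w, g w ∂ν) {p q : ℕ} {φ : Fin p → 𝒳 → ℝ}
    {ψ : Fin q → 𝒴 → ℝ} (hφ : ∀ i, Measurable (φ i)) (hψ : ∀ j, Measurable (ψ j))
    (hφb : ∀ i x, |φ i x| ≤ 1) (hψb : ∀ j y, |ψ j y| ≤ 1)
    (hφ1 : ∃ a : Fin p → ℝ, ∀ x, ∑ i, a i * φ i x = 1)
    (hψ1 : ∃ b : Fin q → ℝ, ∀ y, ∑ j, b j * ψ j y = 1) {δ : ℝ} (hδ : 0 < δ)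
    (hφs : ∀ t ∈ spectrum ℝ (secondMomentMatrix E fun i (w : 𝒳 × 𝒴) => φ i w.1), δ ≤ t)
    (hψs : ∀ t ∈ spectrum ℝ (secondMomentMatrix E fun j (w : 𝒳 × 𝒴) => ψ j w.2), δ ≤ t)
    (hk : ∀ u, 0 ≤ k₀ u) (hh : 0 < h) (hn : n ≠ 0) {r c₁ η : ℝ} (hr : 0 < r) (hc₁ : 1 / r ≤ c₁)
    (hη : ∀ s t, |kernelAvg k₀ n h x y z' z (fun w => basisFun φ ψ s w * basisFun φ ψ t w) -
      E (fun w => basisFun φ ψ s w * basisFun φ ψ t w) * r| ≤ η) :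
    |maxBasisCorr (kernelMean k₀ n h x y z' z) φ ψ - maxBasisCorr E φ ψ| ≤
      32 * c₁ * max 1 (δ⁻¹ * ((p : ℝ) + q)) * η := by
  have hη0 : 0 ≤ η := (abs_nonneg _).trans (hη none none)
  have hc₁0 : 0 < c₁ := lt_of_lt_of_le (by positivity) hc₁
  have hrc : 1 ≤ c₁ * r := by rwa [div_le_iff₀ hr] at hc₁
  have hK1 := le_max_left (1 : ℝ) (δ⁻¹ * ((p : ℝ) + q))
  have hK2 := le_max_right (1 : ℝ) (δ⁻¹ * ((p : ℝ) + q))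
  set K := max (1 : ℝ) (δ⁻¹ * ((p : ℝ) + q)) with hK
  set D := kernelAvg k₀ n h x y z' z (fun _ => 1) with hD
  -- The pair (`none`, `none`) is the function 1, whose kernel average is the density estimate.
  have hD1 : |D - r| ≤ η := by
    have := hη none none
    simp only [basisFun, mul_one, hE, integral_const, probReal_univ, smul_eq_mul, one_mul] at this
    exact this
  obtain ⟨l0, l1⟩ := maxBasisCorr_kernelMean_mem (n := n) (x := x) (y := y) (z := z) (z' := z')
    hφ hψ hφb hψb hk hh
  obtain ⟨m0, m1⟩ := maxBasisCorr_mem hE hφ hψ hφb hψb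
  -- If D < r/2, then η ≥ r/2 ≥ 1/(2c₁) and the right side exceeds 1. Otherwise D ≥ r/2 ≥ 1/(2c₁),
  -- and ratios with denominator D are stable.
  rcases lt_or_ge D (r / 2) with hlt | hge
  · have h1 : r / 2 ≤ η := by have := (abs_le.1 hD1).1; linarith
    have h2 : 1 ≤ 2 * c₁ * η := by nlinarith
    have h3 : 2 * c₁ * η ≤ 32 * c₁ * K * η := by
      have : 0 ≤ c₁ * η := by positivity
      nlinarith
    exact abs_le.2 ⟨by linarith, by linarith⟩
  have hDpos : 0 < D := by linarith
  have hDne : ∑ i ∈ Finset.range n, scaledKernel k₀ h (z - z' i) ≠ 0 := by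
    intro h0
    simp [hD, kernelAvg, h0] at hDpos
  have := isProbabilityMeasure_kernelMeasure (x := x) (y := y) hk hh hDne
  set ν' := kernelMeasure k₀ n h x y z' z with hν'
  have hE' := fun g hg => kernelMean_eq_integral (n := n) (x := x) (y := y) (z := z) (z' := z')
    (g := g) hk hh hg
  have hbm := fun s => measurable_basisFun hφ hψ s
  have hbb := fun s w => abs_basisFun_le hφb hψb s w
  have hdiff : ∀ s t, |∫ w, basisFun φ ψ s w * basisFun φ ψ t w ∂ν' -
      ∫ w, basisFun φ ψ s w * basisFun φ ψ t w ∂ν| ≤ 4 * c₁ * η := by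
    intro s t
    have hb : |E (fun w => basisFun φ ψ s w * basisFun φ ψ t w)| ≤ 1 := by
      rw [hE]
      refine abs_integral_le_one fun w => ?_
      rw [abs_mul]
      exact mul_le_one₀ (hbb s w) (abs_nonneg _) (hbb t w)
    have hst := hη s t
    rw [← hE' (fun w => basisFun φ ψ s w * basisFun φ ψ t w) ((hbm s).mul (hbm t)), ← hE,
      kernelMean_eq_div hn, ← hD]
    set e := E (fun w => basisFun φ ψ s w * basisFun φ ψ t w)
    set N := kernelAvg k₀ n h x y z' z (fun w => basisFun φ ψ s w * basisFun φ ψ t w)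
    -- The numerator is at most 2η because |e| ≤ 1; dividing by D costs 2c₁, hence 4c₁η.
    have e1 : N / D - e = ((N - e * r) - e * (D - r)) / D := by field_simp; ring
    rw [e1, abs_div, abs_of_pos hDpos, div_le_iff₀ hDpos]
    have h1 : |e * (D - r)| ≤ 1 * η := by
      rw [abs_mul]; exact mul_le_mul hb hD1 (abs_nonneg _) zero_le_one
    have h2 := abs_sub (N - e * r) (e * (D - r))
    have h3 : 1 ≤ 2 * c₁ * D := by nlinarith
    nlinarith
  have hu : ∀ i, Measurable fun w : 𝒳 × 𝒴 => φ i w.1 := fun i => (hφ i).comp measurable_fst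
  have hv : ∀ j, Measurable fun w : 𝒳 × 𝒴 => ψ j w.2 := fun j => (hψ j).comp measurable_snd
  rw [maxBasisCorr_eq_corrSup hE' hφ hψ, maxBasisCorr_eq_corrSup (fun g _ => hE g) hφ hψ]
  -- Every moment needed is a product of two functions among 1, φ_i, ψ_j; first moments come from
  -- pairing with `none`. The constant 32 is 8 · 4.
  have hmain := abs_corrSup_sub_corrSup_le (ν := ν) (ν' := ν') (δ := δ) (η := 4 * c₁ * η)
    (u := fun i w => φ i w.1) (v := fun j w => ψ j w.2) hu hv
    (fun i w => hφb i w.1) (fun j w => hψb j w.2)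
    (hφ1.imp fun a ha w => ha w.1) (hψ1.imp fun a ha w => ha w.2) hδ (by positivity)
    (le_integral_sq_of_spectrum hE (fun i => memLp_two_of_abs_le_one (hu i) fun w => hφb i w.1) hφs)
    (le_integral_sq_of_spectrum hE (fun i => memLp_two_of_abs_le_one (hv i) fun w => hψb i w.2) hψs)
    (fun i j => hdiff (some (Sum.inl i)) (some (Sum.inl j)))
    (fun i j => hdiff (some (Sum.inr i)) (some (Sum.inr j)))
    (fun i j => hdiff (some (Sum.inl i)) (some (Sum.inr j)))
    (fun i => by simpa [basisFun] using hdiff (some (Sum.inl i)) none)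
    (fun j => by simpa [basisFun] using hdiff (some (Sum.inr j)) none)
  refine hmain.trans ?_
  calc 8 * (((p : ℝ) + q) / δ * (4 * c₁ * η)) = 32 * c₁ * (δ⁻¹ * ((p : ℝ) + q)) * η := by
        rw [div_eq_mul_inv]; ring
    _ ≤ _ := by gcongr

end Pointwise

/-! ### Taylor bounds from bounds on partial derivatives -/

section Taylor

variable {d : ℕ} {g g₁ g₂ : EuclideanSpace ℝ (Fin d) → ℝ} {z : EuclideanSpace ℝ (Fin d)}

/-- Expand the argument in the standard basis and bound each coordinate by the norm. -/
theorem norm_le_of_abs_apply_single_le {F : Type*} [NormedAddCommGroup F] [NormedSpace ℝ F]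
    (T : EuclideanSpace ℝ (Fin d) →L[ℝ] F) {M : ℝ} (hM : 0 ≤ M)
    (h : ∀ i, ‖T (EuclideanSpace.single i 1)‖ ≤ M) : ‖T‖ ≤ d * M := by
  refine T.opNorm_le_bound (by positivity) fun x => ?_
  have hx : x = ∑ i, x i • EuclideanSpace.single i (1 : ℝ) := by
    ext j
    simp [Pi.single_apply]
  calc ‖T x‖ = ‖∑ i, x i • T (EuclideanSpace.single i 1)‖ := by
        conv_lhs => rw [hx]
        simp
    _ ≤ ∑ i, ‖x i • T (EuclideanSpace.single i 1)‖ := norm_sum_le _ _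
    _ ≤ ∑ _i : Fin d, ‖x‖ * M := by
        refine Finset.sum_le_sum fun i _ => ?_
        rw [norm_smul]
        exact mul_le_mul (PiLp.norm_apply_le x i) (h i) (norm_nonneg _) (norm_nonneg _)
    _ = d * M * ‖x‖ := by simp; ring

theorem norm_fderiv_le_of_partialDer {M : ℝ} (hM : 0 ≤ M) (h : ∀ i, |partialDer i g z| ≤ M) :
    ‖fderiv ℝ g z‖ ≤ d * M :=
  norm_le_of_abs_apply_single_le _ hM h

/-- Iterated partial derivatives are the entries of the second derivative, so the coordinate bound
is applied twice. -/
theorem norm_fderiv_fderiv_le_of_partialDer {M : ℝ} (hM : 0 ≤ M)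
    (hd : DifferentiableAt ℝ (fderiv ℝ g) z)
    (h : ∀ i j, |partialDer i (partialDer j g) z| ≤ M) :
    ‖fderiv ℝ (fderiv ℝ g) z‖ ≤ d * (d * M) := by
  refine norm_le_of_abs_apply_single_le _ (by positivity) fun i =>
    norm_le_of_abs_apply_single_le _ hM fun j => ?_
  have e : partialDer i (partialDer j g) z =
      fderiv ℝ (fderiv ℝ g) z (EuclideanSpace.single i 1) (EuclideanSpace.single j 1) := by
    have : HasFDerivAt (fun y => fderiv ℝ g y (EuclideanSpace.single j (1 : ℝ)))
        ((fderiv ℝ (fderiv ℝ g) z).flip (EuclideanSpace.single j 1)) z := by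
      simpa using hd.hasFDerivAt.clm_apply (hasFDerivAt_const (EuclideanSpace.single j (1 : ℝ)) z)
    unfold partialDer
    rw [this.fderiv]
    rfl
  rw [Real.norm_eq_abs, ← e]
  exact h i j

/-- First and second order Taylor bounds on a ball from bounds on the partial derivatives. -/
theorem taylor_of_partialDer {r M : ℝ} (hM : 0 ≤ M) (hg : TwiceDiffOn g (Metric.ball z r))
    (h1 : ∀ x ∈ Metric.ball z r, ∀ i, |partialDer i g x| ≤ M)
    (h2 : ∀ x ∈ Metric.ball z r, ∀ i j, |partialDer i (partialDer j g) x| ≤ M)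
    {x : EuclideanSpace ℝ (Fin d)} (hx : x ∈ Metric.ball z r) :
    |g x - g z| ≤ d * M * ‖x - z‖ ∧
      |g x - g z - fderiv ℝ g z (x - z)| ≤ d * (d * M) * ‖x - z‖ ^ 2 := by
  have hr : 0 < r := dist_nonneg.trans_lt hx
  have hz : z ∈ Metric.ball z r := Metric.mem_ball_self hr
  constructor
  · exact (convex_ball z r).norm_image_sub_le_of_norm_fderiv_le (𝕜 := ℝ) (fun y hy => (hg y hy).1)
      (fun y hy => norm_fderiv_le_of_partialDer hM (h1 y hy)) hz hx
  · have hseg : segment ℝ z x ⊆ Metric.ball z r := (convex_ball z r).segment_subset hz hx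
    -- The mean value inequality is applied first to the derivative and then, on the segment, to g
    -- minus its linear part. Pointwise twice differentiability suffices, with no continuity of
    -- second derivatives.
    have hbd : ∀ y ∈ segment ℝ z x, ‖fderiv ℝ g y - fderiv ℝ g z‖ ≤ d * (d * M) * ‖x - z‖ := by
      intro y hy
      have := (convex_ball z r).norm_image_sub_le_of_norm_fderiv_le (𝕜 := ℝ) (f := fderiv ℝ g)
        (fun y hy => (hg y hy).2)
        (fun y hy => norm_fderiv_fderiv_le_of_partialDer hM (hg y hy).2 (h2 y hy)) hz (hseg hy)
      refine this.trans ?_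
      have := norm_sub_le_of_mem_segment hy
      gcongr
    have := (convex_segment z x).norm_image_sub_le_of_norm_fderiv_le' (𝕜 := ℝ)
      (fun y hy => (hg y (hseg hy)).1) hbd (left_mem_segment ℝ z x) (right_mem_segment ℝ z x)
    rw [Real.norm_eq_abs] at this
    refine this.trans_eq ?_
    ring

/-- Second order expansion of a product. -/
theorem taylor_mul_of_partialDer {r c M : ℝ} (hr : 0 < r) (hc : 0 ≤ c) (hM : 0 ≤ M)
    (hg₁ : TwiceDiffOn g₁ (Metric.ball z r)) (hg₂ : TwiceDiffOn g₂ (Metric.ball z r))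
    (h10 : ∀ x ∈ Metric.ball z r, |g₁ x| ≤ M)
    (h11 : ∀ x ∈ Metric.ball z r, ∀ i, |partialDer i g₁ x| ≤ M)
    (h12 : ∀ x ∈ Metric.ball z r, ∀ i j, |partialDer i (partialDer j g₁) x| ≤ M)
    (h20 : ∀ x ∈ Metric.ball z r, |g₂ x| ≤ c)
    (h21 : ∀ x ∈ Metric.ball z r, ∀ i, |partialDer i g₂ x| ≤ c)
    (h22 : ∀ x ∈ Metric.ball z r, ∀ i j, |partialDer i (partialDer j g₂) x| ≤ c) :
    ∃ ℓ : EuclideanSpace ℝ (Fin d) →L[ℝ] ℝ, ‖ℓ‖ ≤ 2 * d * c * M ∧ ∀ x ∈ Metric.ball z r,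
      |g₁ x * g₂ x - g₁ z * g₂ z - ℓ (x - z)| ≤ 3 * d ^ 2 * c * M * ‖x - z‖ ^ 2 := by
  have hz : z ∈ Metric.ball z r := Metric.mem_ball_self hr
  have n1 := norm_fderiv_le_of_partialDer hM (h11 z hz)
  have n2 := norm_fderiv_le_of_partialDer hc (h21 z hz)
  have b1 := h10 z hz
  have b2 := h20 z hz
  -- The product rule supplies the linear part.
  refine ⟨g₁ z • fderiv ℝ g₂ z + g₂ z • fderiv ℝ g₁ z, ?_, fun x hx => ?_⟩
  · refine (norm_add_le _ _).trans ?_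
    rw [norm_smul, norm_smul, Real.norm_eq_abs, Real.norm_eq_abs]
    calc |g₁ z| * ‖fderiv ℝ g₂ z‖ + |g₂ z| * ‖fderiv ℝ g₁ z‖ ≤ M * (d * c) + c * (d * M) := by
          gcongr
      _ = _ := by ring
  · obtain ⟨-, t1⟩ := taylor_of_partialDer hM hg₁ h11 h12 hx
    obtain ⟨s2, t2⟩ := taylor_of_partialDer hc hg₂ h21 h22 hx
    -- Two second order remainders and one product of first order increments, each at most d²cM‖x -
    -- z‖²; hence the factor 3.
    have e : g₁ x * g₂ x - g₁ z * g₂ z - (g₁ z • fderiv ℝ g₂ z + g₂ z • fderiv ℝ g₁ z) (x - z) =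
        (g₁ x - g₁ z - fderiv ℝ g₁ z (x - z)) * g₂ x +
        g₁ z * (g₂ x - g₂ z - fderiv ℝ g₂ z (x - z)) +
        fderiv ℝ g₁ z (x - z) * (g₂ x - g₂ z) := by
      simp only [_root_.add_apply, _root_.smul_apply, smul_eq_mul]
      ring
    have n1' : |fderiv ℝ g₁ z (x - z)| ≤ d * M * ‖x - z‖ :=
      (fderiv ℝ g₁ z).le_of_opNorm_le n1 _
    rw [e]
    refine (abs_add_three _ _ _).trans ?_
    rw [abs_mul, abs_mul, abs_mul]
    calc _ ≤ d * (d * M) * ‖x - z‖ ^ 2 * c + M * (d * (d * c) * ‖x - z‖ ^ 2) +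
          d * M * ‖x - z‖ * (d * c * ‖x - z‖) := by
          have := h20 x hx
          gcongr
      _ = _ := by ring

end Taylor

/-! ### Moments, tails and bias of the kernel -/

section KernelIntegral

variable {d : ℕ} {k₀ : EuclideanSpace ℝ (Fin d) → ℝ}

/-- Half of the Gaussian exponent absorbs the polynomial factor; the other half is integrable. -/
theorem CondK2.integrable_norm_pow_mul (hK1 : CondK1 k₀) (hK2 : CondK2 k₀) (s : ℕ) :
    Integrable fun u => ‖u‖ ^ s * k₀ u := by
  obtain ⟨γ₂, γ₃, h2, h3, hk⟩ := hK2
  have hγ : 0 < γ₃ / 2 := by positivity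
  have hG : Integrable fun u : EuclideanSpace ℝ (Fin d) => Real.exp (-(γ₃ / 2) * ‖u‖ ^ 2) := by
    have := GaussianFourier.integrable_cexp_neg_mul_sq_norm_add (V := EuclideanSpace ℝ (Fin d))
      (b := ((γ₃ / 2 : ℝ) : ℂ)) (by simpa using hγ) 0 0
    refine this.norm.congr (ae_of_all _ fun u => ?_)
    simp only [zero_mul, add_zero, Complex.norm_exp]
    congr 1
    norm_cast
  refine (hG.const_mul (γ₂ ^ d * (1 + s.factorial / (γ₃ / 2) ^ s))).mono'
    ((measurable_norm.pow_const s).mul hK1.measurable).aestronglyMeasurable (ae_of_all _ fun u => ?_)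
  rw [Real.norm_of_nonneg (mul_nonneg (by positivity) (hK1.nonneg u))]
  have hx := norm_nonneg u
  -- Passing to powers of ‖u‖² allows x^s/s! ≤ exp x with x a multiple of ‖u‖².
  have e1 : ‖u‖ ^ s ≤ 1 + (‖u‖ ^ 2) ^ s := by
    have : 0 ≤ (‖u‖ ^ s - 1) ^ 2 := sq_nonneg _
    have e : (‖u‖ ^ 2) ^ s = (‖u‖ ^ s) ^ 2 := by ring
    rw [e]; nlinarith [pow_nonneg hx s]
  have e2 := Real.pow_div_factorial_le_exp (γ₃ / 2 * ‖u‖ ^ 2) (by positivity) s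
  have e3 : (‖u‖ ^ 2) ^ s ≤ s.factorial / (γ₃ / 2) ^ s * Real.exp (γ₃ / 2 * ‖u‖ ^ 2) := by
    rw [div_le_iff₀ (by positivity), mul_pow] at e2
    rw [div_mul_eq_mul_div, le_div_iff₀ (by positivity)]
    linarith
  have e4 : (1 : ℝ) ≤ Real.exp (γ₃ / 2 * ‖u‖ ^ 2) := Real.one_le_exp (by positivity)
  calc ‖u‖ ^ s * k₀ u ≤ ((1 + s.factorial / (γ₃ / 2) ^ s) * Real.exp (γ₃ / 2 * ‖u‖ ^ 2)) *
        (γ₂ ^ d * Real.exp (-γ₃ * ‖u‖ ^ 2)) := by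
        have := hk u
        have := hK1.nonneg u
        gcongr
        linarith
    _ = γ₂ ^ d * (1 + s.factorial / (γ₃ / 2) ^ s) *
        (Real.exp (γ₃ / 2 * ‖u‖ ^ 2) * Real.exp (-γ₃ * ‖u‖ ^ 2)) := by ring
    _ = _ := by rw [← Real.exp_add]; congr 2; ring

/-- The contribution of `{‖u‖ ≥ R}` to `∫ (1 + ‖u‖) k₀(u) du`. -/
def kernelTail (k₀ : EuclideanSpace ℝ (Fin d) → ℝ) (R : ℝ) : ℝ :=
  ∫ u in (Metric.ball 0 R)ᶜ, (1 + ‖u‖) * k₀ u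

theorem integrable_one_add_norm_mul (hK1 : CondK1 k₀) (hK2 : CondK2 k₀) :
    Integrable fun u => (1 + ‖u‖) * k₀ u := by
  refine (hK1.integrable.add (hK2.integrable_norm_pow_mul hK1 1)).congr (ae_of_all _ fun u => ?_)
  simp only [Pi.add_apply]
  ring

theorem kernelTail_nonneg (hK1 : CondK1 k₀) (R : ℝ) : 0 ≤ kernelTail k₀ R :=
  integral_nonneg fun u => mul_nonneg (by positivity) (hK1.nonneg u)

/-- Markov's trick: 1 ≤ (‖u‖/R)^s where ‖u‖ ≥ R. As s is arbitrary, the tail decays faster than any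
power. -/
theorem kernelTail_le (hK1 : CondK1 k₀) (hK2 : CondK2 k₀) (s : ℕ) :
    ∃ C, 0 ≤ C ∧ ∀ R, 0 < R → kernelTail k₀ R ≤ C * (R⁻¹) ^ s := by
  have hi : Integrable fun u => (1 + ‖u‖) * ‖u‖ ^ s * k₀ u := by
    refine ((hK2.integrable_norm_pow_mul hK1 s).add
      (hK2.integrable_norm_pow_mul hK1 (s + 1))).congr (ae_of_all _ fun u => ?_)
    simp only [Pi.add_apply]
    ring
  have h0 : ∀ u, 0 ≤ (1 + ‖u‖) * ‖u‖ ^ s * k₀ u := fun u =>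
    mul_nonneg (by positivity) (hK1.nonneg u)
  refine ⟨∫ u, (1 + ‖u‖) * ‖u‖ ^ s * k₀ u, integral_nonneg h0, fun R hR => ?_⟩
  calc kernelTail k₀ R ≤ ∫ u in (Metric.ball 0 R)ᶜ, (1 + ‖u‖) * ‖u‖ ^ s * k₀ u * R⁻¹ ^ s := by
        refine setIntegral_mono_on (integrable_one_add_norm_mul hK1 hK2).integrableOn
          (hi.mul_const _).integrableOn Metric.isOpen_ball.measurableSet.compl fun u hu => ?_
        have hu' : R ≤ ‖u‖ := by simpa using hu
        have : 1 ≤ ‖u‖ ^ s * R⁻¹ ^ s := by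
          rw [← mul_pow]
          refine one_le_pow₀ ?_
          rwa [← div_eq_mul_inv, one_le_div hR]
        have h1 : 0 ≤ (1 + ‖u‖) * k₀ u := mul_nonneg (by positivity) (hK1.nonneg u)
        nlinarith
    _ ≤ ∫ u, (1 + ‖u‖) * ‖u‖ ^ s * k₀ u * R⁻¹ ^ s :=
        setIntegral_le_integral (hi.mul_const _) (ae_of_all _ fun u =>
          mul_nonneg (h0 u) (by positivity))
    _ = _ := integral_mul_const _ _

/-- Substitute x = z - hu; the Jacobian h^d cancels the normalisation of the kernel. -/
theorem integral_scaledKernel_mul {h : ℝ} (hh : 0 < h) (z : EuclideanSpace ℝ (Fin d))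
    (F : EuclideanSpace ℝ (Fin d) → ℝ) :
    ∫ x, scaledKernel k₀ h (z - x) * F x = ∫ u, k₀ u * F (z - h • u) := by
  have h1 := integral_sub_left_eq_self (fun x => scaledKernel k₀ h x * F (z - x)) volume z
  simp only [sub_sub_cancel] at h1
  rw [h1]
  have h2 := Measure.integral_comp_inv_smul_of_nonneg
    (volume : Measure (EuclideanSpace ℝ (Fin d))) (fun u => k₀ u * F (z - h • u)) hh.le
  simp only [smul_inv_smul₀ hh.ne', finrank_euclideanSpace, Fintype.card_fin, smul_eq_mul] at h2
  simp only [scaledKernel, mul_assoc]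
  rw [integral_const_mul, h2, inv_mul_cancel_left₀ (by positivity)]

theorem setIntegral_scaledKernel_mul {h : ℝ} (hh : 0 < h) (z : EuclideanSpace ℝ (Fin d))
    (F : EuclideanSpace ℝ (Fin d) → ℝ) {s : Set (EuclideanSpace ℝ (Fin d))} (hs : MeasurableSet s) :
    ∫ x in s, scaledKernel k₀ h (z - x) * F x =
      ∫ u in (fun u => z - h • u) ⁻¹' s, k₀ u * F (z - h • u) := by
  have hm : Measurable fun u : EuclideanSpace ℝ (Fin d) => z - h • u := by fun_prop
  rw [← integral_indicator hs, ← integral_indicator (hm hs)]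
  have e := integral_scaledKernel_mul (k₀ := k₀) hh z (s.indicator F)
  have e1 : ∀ x, s.indicator (fun x => scaledKernel k₀ h (z - x) * F x) x =
      scaledKernel k₀ h (z - x) * s.indicator F x := fun x => by
    by_cases hx : x ∈ s <;> simp [hx]
  have e2 : ∀ u, ((fun u => z - h • u) ⁻¹' s).indicator (fun u => k₀ u * F (z - h • u)) u =
      k₀ u * s.indicator F (z - h • u) := fun u => by
    by_cases hx : z - h • u ∈ s
    · simp [hx]
    · simp [hx]
  simp_rw [e1, e2]
  exact e

theorem preimage_ball_sub_smul {h : ℝ} (hh : 0 < h) (z : EuclideanSpace ℝ (Fin d)) (r : ℝ) :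
    (fun u => z - h • u) ⁻¹' Metric.ball z r = Metric.ball 0 (r / h) := by
  ext u
  simp [dist_eq_norm, norm_smul, abs_of_pos hh, lt_div_iff₀ hh, mul_comm]

/-- Bias of the kernel smoother, restricted to a ball, for a function with a second order
expansion. -/
theorem abs_setIntegral_scaledKernel_mul_sub_le (hK1 : CondK1 k₀) (hK2 : CondK2 k₀) {h r M : ℝ}
    (hh : 0 < h) {z : EuclideanSpace ℝ (Fin d)}
    {F : EuclideanSpace ℝ (Fin d) → ℝ} (hF : Measurable F) (hFz : |F z| ≤ M)
    {ℓ : EuclideanSpace ℝ (Fin d) →L[ℝ] ℝ} (hℓ : ‖ℓ‖ ≤ M)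
    (hT : ∀ x ∈ Metric.ball z r, |F x - F z - ℓ (x - z)| ≤ M * ‖x - z‖ ^ 2) :
    |(∫ x in Metric.ball z r, scaledKernel k₀ h (z - x) * F x) - F z| ≤
      M * (h ^ 2 * (∫ u, ‖u‖ ^ 2 * k₀ u) + (1 + h) * kernelTail k₀ (r / h)) := by
  have hM : 0 ≤ M := (abs_nonneg _).trans hFz
  rw [setIntegral_scaledKernel_mul hh _ _ Metric.isOpen_ball.measurableSet, preimage_ball_sub_smul hh]
  set B := Metric.ball (0 : EuclideanSpace ℝ (Fin d)) (r / h) with hB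
  have hBm : MeasurableSet B := Metric.isOpen_ball.measurableSet
  have hmem : ∀ u ∈ B, z - h • u ∈ Metric.ball z r := fun u hu => by
    have : ‖u‖ < r / h := by simpa [hB] using hu
    rw [lt_div_iff₀ hh] at this
    simpa [dist_eq_norm, norm_smul, abs_of_pos hh, mul_comm] using this
  -- The Taylor remainder in the rescaled variable; the sign is + because x - z = -hu.
  set Rm : EuclideanSpace ℝ (Fin d) → ℝ := fun u => k₀ u * (F (z - h • u) - F z + h * ℓ u) with hRm
  have hRb : ∀ u ∈ B, ‖Rm u‖ ≤ M * h ^ 2 * (‖u‖ ^ 2 * k₀ u) := fun u hu => by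
    have := hT _ (hmem u hu)
    rw [sub_sub_cancel_left, norm_neg, norm_smul, Real.norm_of_nonneg hh.le, map_neg, map_smul,
      smul_eq_mul, sub_neg_eq_add] at this
    rw [hRm, norm_mul, Real.norm_of_nonneg (hK1.nonneg u), Real.norm_eq_abs]
    calc _ ≤ k₀ u * (M * (h * ‖u‖) ^ 2) := mul_le_mul_of_nonneg_left this (hK1.nonneg u)
      _ = _ := by ring
  have hRmm : Measurable Rm := by
    refine hK1.measurable.mul (((hF.comp (by fun_prop)).sub_const _).add ?_)
    exact ℓ.continuous.measurable.const_mul h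
  have hI2 : Integrable fun u => M * h ^ 2 * (‖u‖ ^ 2 * k₀ u) := hK1.integrable_sq.const_mul _
  have hRi : IntegrableOn Rm B := hI2.integrableOn.mono' hRmm.aestronglyMeasurable
    ((ae_restrict_iff' hBm).2 (ae_of_all _ hRb))
  have hLi : Integrable fun u => k₀ u * ℓ u := by
    refine (ℓ.integrable_comp hK1.integrable_id).congr (ae_of_all _ fun u => ?_)
    simp
  have hL0 : ∫ u, k₀ u * ℓ u = 0 := by
    have := ℓ.integral_comp_comm hK1.integrable_id
    simpa [hK1.mean_zero] using this
  have hsplit : ∫ u in B, k₀ u * F (z - h • u) =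
      F z * (∫ u in B, k₀ u) - h * (∫ u in B, k₀ u * ℓ u) + ∫ u in B, Rm u := by
    have i1 : IntegrableOn (fun u => F z * k₀ u) B := (hK1.integrable.const_mul _).integrableOn
    have i2 : IntegrableOn (fun u => h * (k₀ u * ℓ u)) B := (hLi.const_mul _).integrableOn
    rw [← integral_const_mul, ← integral_const_mul, ← integral_sub i1 i2,
      ← integral_add (f := fun u => F z * k₀ u - h * (k₀ u * ℓ u)) (i1.sub i2) hRi]
    refine integral_congr_ae (ae_of_all _ fun u => ?_)
    simp only [hRm]
    ring
  -- Mass 1 and mean 0 hold on the whole space; restriction to the ball leaves tail terms.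
  have c1 : ∫ u in B, k₀ u = 1 - ∫ u in Bᶜ, k₀ u := by
    rw [← hK1.integral_one, ← integral_add_compl hBm hK1.integrable]; ring
  have c2 : ∫ u in B, k₀ u * ℓ u = -∫ u in Bᶜ, k₀ u * ℓ u := by
    have := integral_add_compl hBm hLi
    rw [hL0] at this; linarith
  have htail : |∫ u in Bᶜ, k₀ u| ≤ kernelTail k₀ (r / h) := by
    rw [← Real.norm_eq_abs]
    refine norm_integral_le_of_norm_le (integrable_one_add_norm_mul hK1 hK2).integrableOn
      (ae_of_all _ fun u => ?_)
    rw [Real.norm_of_nonneg (hK1.nonneg u)]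
    exact le_mul_of_one_le_left (hK1.nonneg u) (by simp)
  have htail' : |∫ u in Bᶜ, k₀ u * ℓ u| ≤ M * kernelTail k₀ (r / h) := by
    rw [← Real.norm_eq_abs, kernelTail, ← integral_const_mul]
    refine norm_integral_le_of_norm_le
      ((integrable_one_add_norm_mul hK1 hK2).const_mul M).integrableOn (ae_of_all _ fun u => ?_)
    rw [norm_mul, Real.norm_of_nonneg (hK1.nonneg u)]
    have h1 : ‖ℓ u‖ ≤ M * ‖u‖ := ℓ.le_of_opNorm_le hℓ u
    have h2 := hK1.nonneg u
    calc k₀ u * ‖ℓ u‖ ≤ k₀ u * (M * (1 + ‖u‖)) := by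
          refine mul_le_mul_of_nonneg_left (h1.trans ?_) h2
          gcongr
          linarith
      _ = _ := by ring
  have hR : |∫ u in B, Rm u| ≤ M * h ^ 2 * ∫ u, ‖u‖ ^ 2 * k₀ u := by
    rw [← Real.norm_eq_abs, ← integral_const_mul]
    refine (norm_integral_le_of_norm_le hI2.integrableOn
      ((ae_restrict_iff' hBm).2 (ae_of_all _ hRb))).trans ?_
    exact setIntegral_le_integral hI2 (ae_of_all _ fun u =>
      mul_nonneg (by positivity) (mul_nonneg (by positivity) (hK1.nonneg u)))
  have e : (∫ u in B, k₀ u * F (z - h • u)) - F z =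
      -(F z * ∫ u in Bᶜ, k₀ u) + h * (∫ u in Bᶜ, k₀ u * ℓ u) + ∫ u in B, Rm u := by
    rw [hsplit, c1, c2]; ring
  rw [e]
  refine (abs_add_three _ _ _).trans ?_
  rw [abs_neg, abs_mul, abs_mul, abs_of_pos hh]
  have t0 := kernelTail_nonneg hK1 (r / h)
  calc _ ≤ M * kernelTail k₀ (r / h) + h * (M * kernelTail k₀ (r / h)) +
        M * h ^ 2 * ∫ u, ‖u‖ ^ 2 * k₀ u := by gcongr
    _ = _ := by ring

end KernelIntegral

/-! ### Law of the observations and bias of the kernel average -/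

section Law

variable {d : ℕ} {Ω 𝒳 𝒴 : Type*} [MeasurableSpace Ω] [MeasurableSpace 𝒳] [MeasurableSpace 𝒴]
  {P : Measure Ω} {X : Ω → 𝒳} {Y : Ω → 𝒴}
  {Z : Ω → EuclideanSpace ℝ (Fin d)} {𝒵 : Set (EuclideanSpace ℝ (Fin d))} {μ : Measure (𝒳 × 𝒴)}
  {f : 𝒳 × 𝒴 → EuclideanSpace ℝ (Fin d) → ℝ} {fZ : EuclideanSpace ℝ (Fin d) → ℝ}
  {k₀ : EuclideanSpace ℝ (Fin d) → ℝ}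

/-- The joint density of `((X,Y),Z)` with respect to `μ ⊗ Lebesgue`. -/
theorem CondR1.map_eq_withDensity [IsProbabilityMeasure P] [SigmaFinite μ] (hR1 : CondR1 P X Y Z 𝒵 μ f fZ) (hX : Measurable X)
    (hY : Measurable Y) (hZ : Measurable Z) :
    P.map (fun ω => ((X ω, Y ω), Z ω)) = (μ.prod volume).withDensity fun x =>
      ENNReal.ofReal (f x.1 x.2) * ENNReal.ofReal (fZ x.2) := by
  have hfm : Measurable fun x : (𝒳 × 𝒴) × EuclideanSpace ℝ (Fin d) => ENNReal.ofReal (f x.1 x.2) :=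
    hR1.measurable_f.ennreal_ofReal
  have hzm := hR1.measurable_fZ.ennreal_ofReal
  have hT : Measurable fun ω => ((X ω, Y ω), Z ω) := (hX.prodMk hY).prodMk hZ
  have := Measure.isProbabilityMeasure_map (μ := P) hT.aemeasurable
  -- Rectangles determine the law, and the conditional density is specified exactly on these.
  refine Measure.ext_prod fun {A B} hA hB => ?_
  rw [Measure.map_apply hT (hA.prod hB), withDensity_apply _ (hA.prod hB), ← Measure.prod_restrict,
    lintegral_prod_symm' (fun x : (𝒳 × 𝒴) × EuclideanSpace ℝ (Fin d) =>
      ENNReal.ofReal (f x.1 x.2) * ENNReal.ofReal (fZ x.2)) (hfm.mul (hzm.comp measurable_snd))]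
  have h1 := hR1.condDensity A hA B hB
  rw [hR1.density, setLIntegral_withDensity_eq_setLIntegral_mul _ hzm
    (Measurable.lintegral_prod_left' hfm) hB] at h1
  refine Eq.trans ?_ (h1.trans ?_)
  · rfl
  · refine lintegral_congr fun z => ?_
    simp only [Pi.mul_apply]
    have hfz : Measurable fun w => ENNReal.ofReal (f w z) := hfm.comp measurable_prodMk_right
    rw [lintegral_mul_const _ hfz, mul_comm]

/-- The bound is assumed only on 𝒵. The set where the density exceeds c has probability zero because
Z avoids it almost surely, and a set of probability zero on which the density is positive is
Lebesgue null. -/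
theorem CondR1.ae_fZ_le (hR1 : CondR1 P X Y Z 𝒵 μ f fZ) (hZ : Measurable Z)
    (hZ𝒵 : ∀ᵐ ω ∂P, Z ω ∈ 𝒵) {c : ℝ} (hc0 : 0 ≤ c) (hc : ∀ z ∈ 𝒵, |fZ z| ≤ c) :
    ∀ᵐ z, fZ z ≤ c := by
  have hS : MeasurableSet {z | c < fZ z} := measurableSet_lt measurable_const hR1.measurable_fZ
  have h0 : (P.map Z) {z | c < fZ z} = 0 := by
    rw [Measure.map_apply hZ hS]
    refine measure_mono_null (t := {ω | Z ω ∉ 𝒵}) (fun ω hω hmem => ?_) (ae_iff.1 hZ𝒵)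
    exact absurd ((le_abs_self _).trans (hc _ hmem)) (not_le.2 hω)
  rw [hR1.density, withDensity_apply_eq_zero hR1.measurable_fZ.ennreal_ofReal] at h0
  rw [ae_iff]
  refine measure_mono_null (fun z hz => ?_) h0
  have hz' : c < fZ z := not_le.1 hz
  exact ⟨by simpa using hc0.trans_lt hz', hz'⟩

theorem CondR1.integral_comp_le (hR1 : CondR1 P X Y Z 𝒵 μ f fZ) (hZ : Measurable Z) {c : ℝ}
    (hc : ∀ᵐ z, fZ z ≤ c) {F : EuclideanSpace ℝ (Fin d) → ℝ} (hF : Integrable F)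
    (hFm : Measurable F) (h0 : ∀ z, 0 ≤ F z) : ∫ ω, F (Z ω) ∂P ≤ c * ∫ z, F z := by
  rw [← integral_map (f := F) hZ.aemeasurable hFm.aestronglyMeasurable, hR1.density,
    integral_withDensity_eq_integral_toReal_smul hR1.measurable_fZ.ennreal_ofReal
    (ae_of_all _ fun _ => ENNReal.ofReal_lt_top), ← integral_const_mul]
  simp only [ENNReal.toReal_ofReal (hR1.fZ_nonneg _), smul_eq_mul]
  refine integral_mono_of_nonneg (ae_of_all _ fun z => mul_nonneg (hR1.fZ_nonneg z) (h0 z))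
    (hF.const_mul c) ?_
  filter_upwards [hc] with z hz
  exact mul_le_mul_of_nonneg_right hz (h0 z)

theorem integrable_scaledKernel (hK1 : CondK1 k₀) {h : ℝ} (hh : 0 < h)
    (z : EuclideanSpace ℝ (Fin d)) : Integrable fun x => scaledKernel k₀ h (z - x) := by
  have h1 : Integrable fun x => scaledKernel k₀ h x :=
    ((integrable_comp_smul_iff volume k₀ (inv_ne_zero hh.ne')).2 hK1.integrable).const_mul _
  exact h1.comp_sub_left z

theorem measurable_scaledKernel (hK1 : CondK1 k₀) (h : ℝ) : Measurable (scaledKernel k₀ h) :=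
  (hK1.measurable.comp (measurable_const_smul h⁻¹)).const_mul _

theorem scaledKernel_le {C h : ℝ} (hC : ∀ u, k₀ u ≤ C) (hh : 0 < h)
    (u : EuclideanSpace ℝ (Fin d)) : scaledKernel k₀ h u ≤ C / h ^ d := by
  rw [div_eq_inv_mul]
  exact mul_le_mul_of_nonneg_left (hC _) (by positivity)

theorem integral_scaledKernel (hK1 : CondK1 k₀) {h : ℝ} (hh : 0 < h)
    (z : EuclideanSpace ℝ (Fin d)) : ∫ x, scaledKernel k₀ h (z - x) = 1 := by
  have := integral_scaledKernel_mul (k₀ := k₀) hh z fun _ => 1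
  simpa [hK1.integral_one] using this

/-- One kernel factor is bounded by its supremum, of order h^{-d}, and the other integrates to 1.
This is the source of the variance rate 1/(nh^d). -/
theorem CondR1.integral_scaledKernel_sq_le (hR1 : CondR1 P X Y Z 𝒵 μ f fZ) (hZ : Measurable Z)
    (hK1 : CondK1 k₀) {c C h : ℝ} (hc0 : 0 ≤ c) (hc : ∀ᵐ z, fZ z ≤ c) (hC : ∀ u, k₀ u ≤ C)
    (hh : 0 < h) (z : EuclideanSpace ℝ (Fin d)) :
    ∫ ω, scaledKernel k₀ h (z - Z ω) ^ 2 ∂P ≤ c * (C / h ^ d) := by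
  have hb : ∀ x, scaledKernel k₀ h (z - x) ^ 2 ≤ C / h ^ d * scaledKernel k₀ h (z - x) := fun x => by
    rw [sq]
    exact mul_le_mul_of_nonneg_right (scaledKernel_le hC hh _) (scaledKernel_nonneg hK1.nonneg hh _)
  have hm : Measurable fun x => scaledKernel k₀ h (z - x) ^ 2 :=
    ((measurable_scaledKernel hK1 h).comp (by fun_prop)).pow_const 2
  have hi : Integrable fun x => C / h ^ d * scaledKernel k₀ h (z - x) :=
    (integrable_scaledKernel hK1 hh z).const_mul _
  have hsq : Integrable fun x => scaledKernel k₀ h (z - x) ^ 2 :=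
    hi.mono' hm.aestronglyMeasurable (ae_of_all _ fun x => by
      rw [Real.norm_of_nonneg (sq_nonneg _)]; exact hb x)
  refine (hR1.integral_comp_le hZ hc hsq hm fun x => sq_nonneg _).trans ?_
  gcongr
  refine (integral_mono hsq hi hb).trans_eq ?_
  rw [integral_const_mul, integral_scaledKernel hK1 hh, mul_one]

/-- Beyond the ball no smoothness is available, but boundedness of the density suffices. -/
theorem CondR1.integral_scaledKernel_compl_ball_le (hR1 : CondR1 P X Y Z 𝒵 μ f fZ)
    (hZ : Measurable Z) (hK1 : CondK1 k₀) (hK2 : CondK2 k₀) {c h : ℝ} (hc0 : 0 ≤ c)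
    (hc : ∀ᵐ z, fZ z ≤ c) (hh : 0 < h) (z : EuclideanSpace ℝ (Fin d)) (r : ℝ) :
    ∫ ω, (Metric.ball z r)ᶜ.indicator (fun x => scaledKernel k₀ h (z - x)) (Z ω) ∂P ≤
      c * kernelTail k₀ (r / h) := by
  have hB : MeasurableSet (Metric.ball z r)ᶜ := Metric.isOpen_ball.measurableSet.compl
  refine (hR1.integral_comp_le hZ hc ((integrable_scaledKernel hK1 hh z).indicator hB)
    (((measurable_scaledKernel hK1 h).comp (by fun_prop)).indicator hB) fun x =>
    Set.indicator_nonneg (fun x _ => scaledKernel_nonneg hK1.nonneg hh _) x).trans ?_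
  gcongr
  rw [integral_indicator hB]
  have e := setIntegral_scaledKernel_mul (k₀ := k₀) hh z (fun _ => 1) hB
  simp only [mul_one] at e
  rw [e, Set.preimage_compl, preimage_ball_sub_smul hh]
  refine setIntegral_mono hK1.integrable.integrableOn
    (integrable_one_add_norm_mul hK1 hK2).integrableOn fun u => ?_
  exact le_mul_of_one_le_left (hK1.nonneg u) (by simp)

/-- Integration against the law of `((X,Y),Z)`, conditioning on `(X,Y)` last. -/
theorem CondR1.integral_comp_eq [IsProbabilityMeasure P] [SigmaFinite μ] (hR1 : CondR1 P X Y Z 𝒵 μ f fZ) (hX : Measurable X)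
    (hY : Measurable Y) (hZ : Measurable Z) {Φ : (𝒳 × 𝒴) × EuclideanSpace ℝ (Fin d) → ℝ}
    (hΦ : Measurable Φ) {C : ℝ} (hC : ∀ x, |Φ x| ≤ C) :
    ∫ ω, Φ ((X ω, Y ω), Z ω) ∂P =
      ∫ w, (∫ z, (ENNReal.ofReal (f w z) * ENNReal.ofReal (fZ z)).toReal * Φ (w, z)) ∂μ ∧
    Integrable (fun w => ∫ z, (ENNReal.ofReal (f w z) * ENNReal.ofReal (fZ z)).toReal * Φ (w, z))
      μ := by
  have hT : Measurable fun ω => ((X ω, Y ω), Z ω) := (hX.prodMk hY).prodMk hZ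
  have hdm : Measurable fun x : (𝒳 × 𝒴) × EuclideanSpace ℝ (Fin d) =>
      ENNReal.ofReal (f x.1 x.2) * ENNReal.ofReal (fZ x.2) :=
    hR1.measurable_f.ennreal_ofReal.mul (hR1.measurable_fZ.comp measurable_snd).ennreal_ofReal
  have htop : ∀ᵐ x ∂μ.prod (volume : Measure (EuclideanSpace ℝ (Fin d))),
      ENNReal.ofReal (f x.1 x.2) * ENNReal.ofReal (fZ x.2) < ⊤ :=
    ae_of_all _ fun _ => ENNReal.mul_lt_top ENNReal.ofReal_lt_top ENNReal.ofReal_lt_top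
  have := Measure.isProbabilityMeasure_map (μ := P) hT.aemeasurable
  have hint : Integrable Φ (P.map fun ω => ((X ω, Y ω), Z ω)) :=
    Integrable.of_bound hΦ.aestronglyMeasurable C (ae_of_all _ hC)
  have hmap := hR1.map_eq_withDensity hX hY hZ
  rw [hmap] at hint
  have hint' := (integrable_withDensity_iff_integrable_smul' hdm htop).1 hint
  refine ⟨?_, hint'.integral_prod_left⟩
  rw [← integral_map (f := Φ) hT.aemeasurable hΦ.aestronglyMeasurable, hmap,
    integral_withDensity_eq_integral_toReal_smul hdm htop, integral_prod _ hint']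
  rfl

/-- Bias of the kernel average. -/
theorem CondR1.exists_abs_bias_le [IsProbabilityMeasure P] [SigmaFinite μ] (hR1 : CondR1 P X Y Z 𝒵 μ f fZ) (hR2 : CondR2 𝒵 μ f)
    (hR3 : CondR3 𝒵 fZ) (hX : Measurable X) (hY : Measurable Y) (hZ : Measurable Z)
    (hZ𝒵 : ∀ᵐ ω ∂P, Z ω ∈ 𝒵) (hK1 : CondK1 k₀) (hK2 : CondK2 k₀) :
    ∃ A, 0 ≤ A ∧ ∀ g : 𝒳 × 𝒴 → ℝ, Measurable g → (∀ w, |g w| ≤ 1) → ∀ h r : ℝ, 0 < h → 0 < r →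
      ∀ z ∈ innerSet 𝒵 r,
        |∫ ω, g (X ω, Y ω) * scaledKernel k₀ h (z - Z ω) ∂P - condMean μ f z g * fZ z| ≤
          A * (h ^ 2 + (1 + h) * kernelTail k₀ (r / h)) := by
  obtain ⟨H, hH, hf0, hf1, hf2⟩ := hR2
  obtain ⟨c₀, c₁, hz0, hz1, hz2, -⟩ := hR3
  obtain ⟨C, hC⟩ := hK1.bounded
  set c := max c₀ 0 with hc
  have hc0 : 0 ≤ c := le_max_right _ _
  have hcle : c₀ ≤ c := le_max_left _ _
  have hae : ∀ᵐ z, fZ z ≤ c := hR1.ae_fZ_le hZ hZ𝒵 hc0 fun z hz => (hz0 z hz).trans hcle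
  set κ := ∫ u, ‖u‖ ^ 2 * k₀ u with hκ
  have hκ0 : 0 ≤ κ := integral_nonneg fun u => mul_nonneg (by positivity) (hK1.nonneg u)
  -- One constant dominating the bounds c, 2dc and 3d²c for the value, the linear part and the
  -- remainder of f(w,·)f_Z, each relative to H(w).
  set B := c + 2 * d * c + 3 * d ^ 2 * c with hB
  have hB0 : 0 ≤ B := by positivity
  -- H is known to be nonnegative only once 𝒵 has a point, so the absolute value secures the sign of
  -- the constant.
  set IH := |∫ w, H w ∂μ|
  refine ⟨B * IH * (κ + 1) + c, by positivity, fun g hg hg1 h r hh hr z hz => ?_⟩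
  obtain ⟨hz𝒵, hball⟩ := hz
  have hball' : Metric.ball z r ⊆ 𝒵 := fun x hx => hball (by simpa [dist_eq_norm] using hx)
  have hint : Metric.ball z r ⊆ interior 𝒵 := interior_maximal hball' Metric.isOpen_ball
  have hBm : MeasurableSet (Metric.ball z r) := Metric.isOpen_ball.measurableSet
  have hzb : z ∈ Metric.ball z r := Metric.mem_ball_self hr
  have hH0 : ∀ w, 0 ≤ H w := fun w => (abs_nonneg _).trans (hf0 w z hz𝒵)
  set T := kernelTail k₀ (r / h) with hT
  have hT0 : 0 ≤ T := kernelTail_nonneg hK1 _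
  have hkm : Measurable fun x => scaledKernel k₀ h (z - x) :=
    (measurable_scaledKernel hK1 h).comp (by fun_prop)
  have hkn := fun x => scaledKernel_nonneg hK1.nonneg hh (z - x)
  have hkb := fun x => scaledKernel_le hC hh (z - x)
  -- the part inside the ball
  set Φ : (𝒳 × 𝒴) × EuclideanSpace ℝ (Fin d) → ℝ := fun x =>
    g x.1 * (Metric.ball z r).indicator (fun x => scaledKernel k₀ h (z - x)) x.2 with hΦ
  have hΦm : Measurable Φ := (hg.comp measurable_fst).mul ((hkm.indicator hBm).comp measurable_snd)
  have hC0 : 0 ≤ C / h ^ d := (hkn 0).trans (hkb 0)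
  have hΦb : ∀ x, |Φ x| ≤ C / h ^ d := fun x => by
    have h1 : 0 ≤ (Metric.ball z r).indicator (fun x => scaledKernel k₀ h (z - x)) x.2 :=
      Set.indicator_nonneg (fun x _ => hkn x) _
    have h2 : (Metric.ball z r).indicator (fun x => scaledKernel k₀ h (z - x)) x.2 ≤ C / h ^ d :=
      Set.indicator_apply_le' (fun _ => hkb _) fun _ => hC0
    rw [hΦ, abs_mul, abs_of_nonneg h1]
    calc _ ≤ 1 * (C / h ^ d) := mul_le_mul (hg1 _) h2 h1 zero_le_one
      _ = _ := one_mul _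
  obtain ⟨hin, hini⟩ := hR1.integral_comp_eq hX hY hZ hΦm hΦb
  -- Inside the ball f is nonnegative, so the truncation by `ENNReal.ofReal` is harmless; outside,
  -- where its sign is unknown, Φ vanishes.
  have hinner : ∀ w, ∫ x, (ENNReal.ofReal (f w x) * ENNReal.ofReal (fZ x)).toReal * Φ (w, x) =
      g w * ∫ x in Metric.ball z r, scaledKernel k₀ h (z - x) * (f w x * fZ x) := fun w => by
    rw [← integral_const_mul, ← integral_indicator hBm]
    refine integral_congr_ae (ae_of_all _ fun x => ?_)
    by_cases hx : x ∈ Metric.ball z r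
    · simp only [hΦ, Set.indicator_of_mem hx, ENNReal.toReal_mul,
        ENNReal.toReal_ofReal (hR1.f_nonneg x (hball' hx) w), ENNReal.toReal_ofReal (hR1.fZ_nonneg x)]
      ring
    · simp only [hΦ, Set.indicator_of_notMem hx, mul_zero]
  simp only [hinner] at hin hini
  have hfm : Measurable fun w => f w z := hR1.measurable_f.comp measurable_prodMk_right
  have hgf : Integrable (fun w => g w * f w z) μ :=
    hH.mono' (hg.mul hfm).aestronglyMeasurable (ae_of_all _ fun w => by
      rw [norm_mul]
      calc _ ≤ 1 * H w := mul_le_mul (hg1 w) (hf0 w z hz𝒵) (abs_nonneg _) zero_le_one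
        _ = _ := one_mul _)
  -- The expansion is made at fixed w, with constants proportional to H(w), and integrated over w
  -- only afterwards.
  have hpt : ∀ w, |(∫ x in Metric.ball z r, scaledKernel k₀ h (z - x) * (f w x * fZ x)) -
      f w z * fZ z| ≤ (B * H w) * (h ^ 2 * κ + (1 + h) * T) := by
    intro w
    obtain ⟨ℓ, hℓ, hTay⟩ := taylor_mul_of_partialDer (g₁ := f w) (g₂ := fZ) hr hc0 (hH0 w)
      (fun x hx => hR1.f_twice w x (hint hx)) (fun x hx => hR1.fZ_twice x (hint hx))
      (fun x hx => hf0 w x (hball' hx)) (fun x hx => hf1 w x (hint hx))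
      (fun x hx => hf2 w x (hint hx)) (fun x hx => (hz0 x (hball' hx)).trans hcle)
      (fun x hx i => (hz1 x (hint hx) i).trans hcle)
      (fun x hx i j => (hz2 x (hint hx) i j).trans hcle)
    have hHw := hH0 w
    have p1 : 0 ≤ c * H w := by positivity
    have p2 : 0 ≤ 2 * d * c * H w := by positivity
    have p3 : 0 ≤ 3 * d ^ 2 * c * H w := by positivity
    have hBw : B * H w = c * H w + 2 * d * c * H w + 3 * d ^ 2 * c * H w := by rw [hB]; ring
    refine abs_setIntegral_scaledKernel_mul_sub_le (F := fun x => f w x * fZ x) (ℓ := ℓ) hK1 hK2 hh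
      ((hR1.measurable_f.comp measurable_prodMk_left).mul hR1.measurable_fZ) ?_ ?_ ?_
    · rw [abs_mul]
      calc _ ≤ H w * c := mul_le_mul (hf0 w z hz𝒵) ((hz0 z hz𝒵).trans hcle) (abs_nonneg _) (hH0 w)
        _ ≤ B * H w := by linarith
    · linarith
    · intro x hx
      refine (hTay x hx).trans (mul_le_mul_of_nonneg_right ?_ (sq_nonneg _))
      linarith
  have hinside : |∫ ω, Φ ((X ω, Y ω), Z ω) ∂P - condMean μ f z g * fZ z| ≤
      B * IH * (h ^ 2 * κ + (1 + h) * T) := by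
    have e : ∫ ω, Φ ((X ω, Y ω), Z ω) ∂P - condMean μ f z g * fZ z =
        ∫ w, g w * ((∫ x in Metric.ball z r, scaledKernel k₀ h (z - x) * (f w x * fZ x)) -
          f w z * fZ z) ∂μ := by
      rw [hin, condMean, ← integral_mul_const, ← integral_sub hini (hgf.mul_const _)]
      refine integral_congr_ae (ae_of_all _ fun w => ?_)
      simp only
      ring
    rw [e, ← Real.norm_eq_abs]
    have hb : ∀ w, ‖g w * ((∫ x in Metric.ball z r, scaledKernel k₀ h (z - x) * (f w x * fZ x)) -
        f w z * fZ z)‖ ≤ H w * (B * (h ^ 2 * κ + (1 + h) * T)) := fun w => by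
      rw [norm_mul]
      calc _ ≤ 1 * ((B * H w) * (h ^ 2 * κ + (1 + h) * T)) :=
            mul_le_mul (hg1 w) (hpt w) (abs_nonneg _) zero_le_one
        _ = _ := by ring
    refine (norm_integral_le_of_norm_le (hH.mul_const _) (ae_of_all _ hb)).trans ?_
    rw [integral_mul_const]
    calc _ ≤ IH * (B * (h ^ 2 * κ + (1 + h) * T)) :=
          mul_le_mul_of_nonneg_right (le_abs_self _) (by positivity)
      _ = _ := by ring
  -- the part outside the ball
  set Ψ : Ω → ℝ := fun ω => g (X ω, Y ω) *
    (Metric.ball z r)ᶜ.indicator (fun x => scaledKernel k₀ h (z - x)) (Z ω) with hΨ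
  have hindm : Measurable fun ω => (Metric.ball z r)ᶜ.indicator
      (fun x => scaledKernel k₀ h (z - x)) (Z ω) := (hkm.indicator hBm.compl).comp hZ
  have hind0 : ∀ ω, 0 ≤ (Metric.ball z r)ᶜ.indicator
      (fun x => scaledKernel k₀ h (z - x)) (Z ω) := fun ω =>
    Set.indicator_nonneg (fun x _ => hkn x) _
  have hindi : Integrable (fun ω => (Metric.ball z r)ᶜ.indicator
      (fun x => scaledKernel k₀ h (z - x)) (Z ω)) P :=
    Integrable.of_bound hindm.aestronglyMeasurable (C / h ^ d) (ae_of_all _ fun ω => by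
      rw [Real.norm_of_nonneg (hind0 ω)]
      exact Set.indicator_apply_le' (fun _ => hkb _) fun _ => hC0)
  have hΨb : ∀ ω, ‖Ψ ω‖ ≤ (Metric.ball z r)ᶜ.indicator
      (fun x => scaledKernel k₀ h (z - x)) (Z ω) := fun ω => by
    rw [hΨ, norm_mul, Real.norm_of_nonneg (hind0 ω)]
    exact mul_le_of_le_one_left (hind0 ω) (hg1 _)
  have hΨi : Integrable Ψ P := hindi.mono' ((hg.comp (hX.prodMk hY)).mul hindm).aestronglyMeasurable
    (ae_of_all _ hΨb)
  have houtside : |∫ ω, Ψ ω ∂P| ≤ c * T :=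
    (norm_integral_le_of_norm_le hindi (ae_of_all _ hΨb)).trans
      (hR1.integral_scaledKernel_compl_ball_le hZ hK1 hK2 hc0 hae hh z r)
  have hΦi : Integrable (fun ω => Φ ((X ω, Y ω), Z ω)) P :=
    Integrable.of_bound (hΦm.comp ((hX.prodMk hY).prodMk hZ)).aestronglyMeasurable (C / h ^ d)
      (ae_of_all _ fun ω => hΦb _)
  have hsum : ∫ ω, g (X ω, Y ω) * scaledKernel k₀ h (z - Z ω) ∂P =
      ∫ ω, Φ ((X ω, Y ω), Z ω) ∂P + ∫ ω, Ψ ω ∂P := by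
    rw [← integral_add hΦi hΨi]
    refine integral_congr_ae (ae_of_all _ fun ω => ?_)
    simp only [hΦ, hΨ, ← mul_add]
    rw [Set.indicator_self_add_compl_apply]
  rw [hsum, add_sub_right_comm]
  refine (abs_add_le _ _).trans ((add_le_add hinside houtside).trans ?_)
  have hBI : 0 ≤ B * IH := by positivity
  have q1 : B * IH * (h ^ 2 * κ + (1 + h) * T) ≤
      B * IH * (κ + 1) * (h ^ 2 + (1 + h) * T) := by
    rw [mul_assoc (B * IH)]
    refine mul_le_mul_of_nonneg_left ?_ hBI
    have : 0 ≤ (1 + h) * T := by positivity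
    nlinarith [sq_nonneg h]
  have q2 : c * T ≤ c * (h ^ 2 + (1 + h) * T) := by
    refine mul_le_mul_of_nonneg_left ?_ hc0
    have : 0 ≤ h * T := by positivity
    nlinarith [sq_nonneg h]
  rw [add_mul]
  linarith

end Law

/-! ### Mean squared error of averages and Markov's inequality -/

section Average

variable {Ω S : Type*} [MeasurableSpace Ω] [MeasurableSpace S] {P : Measure Ω}
  [IsProbabilityMeasure P]

/-- Mean squared error of an average of i.i.d. bounded random variables. -/
theorem integral_sq_average_sub_le {T : ℕ → Ω → S} {T₀ : Ω → S} (hindep : iIndepFun T P)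
    (hident : ∀ i, IdentDistrib (T i) T₀ P P) {G : S → ℝ} (hG : Measurable G) {K : ℝ}
    (hK : ∀ s, |G s| ≤ K) {v b m : ℝ} (hv : ∫ ω, G (T₀ ω) ^ 2 ∂P ≤ v)
    (hb : |∫ ω, G (T₀ ω) ∂P - m| ≤ b) {n : ℕ} (hn : n ≠ 0) :
    Integrable (fun ω => ((n : ℝ)⁻¹ * ∑ i ∈ Finset.range n, G (T i ω) - m) ^ 2) P ∧
      ∫ ω, ((n : ℝ)⁻¹ * ∑ i ∈ Finset.range n, G (T i ω) - m) ^ 2 ∂P ≤ v / n + b ^ 2 := by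
  have hW : ∀ i, MemLp (fun ω => G (T i ω)) 2 P := fun i =>
    MemLp.of_bound (hG.comp_aemeasurable (hident i).aemeasurable_fst).aestronglyMeasurable K
      (ae_of_all _ fun ω => hK _)
  have hW₀ : MemLp (fun ω => G (T₀ ω)) 2 P :=
    MemLp.of_bound (hG.comp_aemeasurable (hident 0).aemeasurable_snd).aestronglyMeasurable K
      (ae_of_all _ fun ω => hK _)
  have hid : ∀ i, IdentDistrib (fun ω => G (T i ω)) (fun ω => G (T₀ ω)) P P := fun i =>
    (hident i).comp hG
  have hsumL : MemLp (fun ω => ∑ i ∈ Finset.range n, G (T i ω)) 2 P :=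
    memLp_finsetSum _ fun i _ => hW i
  have hM : MemLp (fun ω => (n : ℝ)⁻¹ * ∑ i ∈ Finset.range n, G (T i ω)) 2 P := hsumL.const_mul _
  set M := fun ω => (n : ℝ)⁻¹ * ∑ i ∈ Finset.range n, G (T i ω) with hMdef
  have hMm : MemLp (fun ω => M ω - m) 2 P := hM.sub (memLp_const m)
  have hmean : ∫ ω, M ω ∂P = ∫ ω, G (T₀ ω) ∂P := by
    rw [hMdef, integral_const_mul, integral_finsetSum _ fun i _ => (hW i).integrable one_le_two,
      Finset.sum_congr rfl fun i _ => (hid i).integral_eq]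
    simp only [Finset.sum_const, Finset.card_range, nsmul_eq_mul]
    rw [inv_mul_cancel_left₀ (by positivity)]
  -- Variances of independent terms add, which yields the factor 1/n.
  have hvar : Var[M; P] = (n : ℝ)⁻¹ * Var[fun ω => G (T₀ ω); P] := by
    have h1 : (fun ω => ∑ i ∈ Finset.range n, G (T i ω)) =
        ∑ i ∈ Finset.range n, fun ω => G (T i ω) := by ext ω; simp
    rw [hMdef, variance_const_mul, h1, IndepFun.variance_sum (fun i _ => hW i)
      fun i _ j _ hij => (hindep.indepFun hij).comp hG hG,
      Finset.sum_congr rfl fun i _ => (hid i).variance_eq]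
    simp only [Finset.sum_const, Finset.card_range, nsmul_eq_mul]
    field_simp
  refine ⟨hMm.integrable_sq, ?_⟩
  -- Mean squared error is variance plus squared bias.
  have h2 := variance_eq_sub hMm
  rw [variance_sub_const hM.aestronglyMeasurable, hvar] at h2
  have h3 : ∫ ω, (M ω - m) ∂P = ∫ ω, G (T₀ ω) ∂P - m := by
    rw [integral_sub (hM.integrable one_le_two) (integrable_const _), hmean]
    simp
  rw [h3] at h2
  have h4 : Var[fun ω => G (T₀ ω); P] ≤ v :=
    (variance_le_expectation_sq hW₀.aestronglyMeasurable).trans hv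
  have h5 : (∫ ω, G (T₀ ω) ∂P - m) ^ 2 ≤ b ^ 2 := sq_le_sq' (abs_le.1 hb).1 (abs_le.1 hb).2
  have h6 : (n : ℝ)⁻¹ * Var[fun ω => G (T₀ ω); P] ≤ v / n := by
    rw [div_eq_inv_mul]; gcongr
  have h7 : ∫ ω, (M ω - m) ^ 2 ∂P = P[(fun ω => M ω - m) ^ 2] := rfl
  rw [h7]
  linarith

/-- Markov's inequality in `O_P` form. -/
theorem isBigOP_of_integral_le {R S : ℕ → Ω → ℝ} {r : ℕ → ℝ} {C : ℝ}
    (h : ∀ᶠ n in atTop, 0 < r n ∧ (∀ ω, |R n ω| ≤ S n ω) ∧ Integrable (S n) P ∧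
      ∫ ω, S n ω ∂P ≤ C * r n) : IsBigOP P R r := by
  intro ε hε
  -- Using |C| + 1 keeps the threshold positive whatever the sign of C.
  refine ⟨(|C| + 1) / ε, by positivity, ?_⟩
  filter_upwards [h] with n ⟨hr, hRS, hS, hI⟩
  have hpos : 0 < (|C| + 1) / ε * r n := by positivity
  have hS0 : ∀ ω, 0 ≤ S n ω := fun ω => (abs_nonneg _).trans (hRS ω)
  have hmk := mul_meas_ge_le_integral_of_nonneg (ae_of_all _ hS0) hS ((|C| + 1) / ε * r n)
  have hle : P.real {ω | (|C| + 1) / ε * r n ≤ S n ω} ≤ ε := by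
    have h1 : (|C| + 1) / ε * r n * P.real {ω | (|C| + 1) / ε * r n ≤ S n ω} ≤
        (|C| + 1) / ε * r n * ε := by
      refine hmk.trans (hI.trans ?_)
      have : (|C| + 1) / ε * r n * ε = (|C| + 1) * r n := by field_simp
      rw [this]
      have := le_abs_self C
      gcongr
      linarith
    exact le_of_mul_le_mul_left h1 hpos
  calc P {ω | (|C| + 1) / ε * r n < |R n ω|} ≤ P {ω | (|C| + 1) / ε * r n ≤ S n ω} :=
        measure_mono fun ω hω => (le_of_lt hω).trans (hRS ω)
    _ = ENNReal.ofReal (P.real {ω | (|C| + 1) / ε * r n ≤ S n ω}) := by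
        rw [ofReal_measureReal]
    _ ≤ _ := ENNReal.ofReal_le_ofReal hle

end Average

/-! ### Bandwidth rates -/

section Rates

variable {d : ℕ} {k₀ : EuclideanSpace ℝ (Fin d) → ℝ}

/-- The squared bias is of order `(n h^d)⁻¹`. -/
theorem exists_sq_bias_mul_le (hK1 : CondK1 k₀) (hK2 : CondK2 k₀) {h ε : ℕ → ℝ}
    (hh : ∀ n, 1 ≤ n → 0 < h n) (hε : ∀ n, 1 ≤ n → 0 < ε n) {α β c : ℝ}
    (hα : 1 / ((d : ℝ) + 4) < α) (hβ : 0 < β) (hc : 0 < c)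
    (hrate : ∀ n : ℕ, 1 ≤ n → h n ≤ c * (n : ℝ) ^ (-α))
    (hhε : (fun n => h n / ε n) =O[atTop] fun n : ℕ => (n : ℝ) ^ (-β)) :
    ∃ C, 0 ≤ C ∧ ∀ᶠ n : ℕ in atTop,
      (h n ^ 2 + (1 + h n) * kernelTail k₀ (ε n / h n)) ^ 2 * (n * h n ^ d) ≤ C := by
  -- With βs ≥ 1 the tail, of order (h/ε)^s, is O(1/n).
  obtain ⟨s, hs⟩ := exists_nat_ge (1 / β)
  have hβs : 1 ≤ β * s := by rwa [div_le_iff₀ hβ, mul_comm] at hs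
  obtain ⟨D, hD0, hD⟩ := kernelTail_le hK1 hK2 s
  obtain ⟨B, hB0, hB⟩ := hhε.exists_pos
  have hα0 : 0 < α := lt_of_le_of_lt (by positivity) hα
  refine ⟨2 * (c ^ (d + 4) + ((1 + c) * (D * B ^ s)) ^ 2 * c ^ d), by positivity, ?_⟩
  filter_upwards [hB.bound, eventually_ge_atTop 1] with n hn hn1
  have hn1' : (1 : ℝ) ≤ n := by exact_mod_cast hn1
  have hn0 : (0 : ℝ) < n := by linarith
  have hhn := hh n hn1
  have hεn := hε n hn1
  have hle := hrate n hn1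
  have hnα : (n : ℝ) ^ (-α) ≤ 1 := Real.rpow_le_one_of_one_le_of_nonpos hn1' (by linarith)
  have hhc : h n ≤ c := hle.trans (mul_le_of_le_one_right hc.le hnα)
  have hT : kernelTail k₀ (ε n / h n) ≤ D * B ^ s * (n : ℝ)⁻¹ := by
    refine (hD _ (div_pos hεn hhn)).trans ?_
    rw [inv_div, mul_assoc]
    gcongr
    rw [Real.norm_of_nonneg (by positivity), Real.norm_of_nonneg (by positivity)] at hn
    calc (h n / ε n) ^ s ≤ (B * (n : ℝ) ^ (-β)) ^ s := by gcongr
      _ = B ^ s * (n : ℝ) ^ (-β * s) := by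
          rw [mul_pow, ← Real.rpow_natCast ((n : ℝ) ^ (-β)), ← Real.rpow_mul hn0.le]
      _ ≤ B ^ s * (n : ℝ) ^ (-1 : ℝ) := by
          gcongr
          linarith
      _ = _ := by rw [Real.rpow_neg_one]
  have hT0 := kernelTail_nonneg hK1 (ε n / h n)
  set T := kernelTail k₀ (ε n / h n)
  -- This is nh^{d+4}, of order n^{1-α(d+4)}, and the exponent is negative.
  have e1 : (h n ^ 2) ^ 2 * (n * h n ^ d) ≤ c ^ (d + 4) := by
    have h1 : h n ^ (d + 4) ≤ (c * (n : ℝ) ^ (-α)) ^ (d + 4) := by gcongr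
    have h2 : ((n : ℝ) ^ (-α)) ^ (d + 4) * n ≤ 1 := by
      rw [← Real.rpow_natCast, ← Real.rpow_mul hn0.le]
      nth_rewrite 2 [← Real.rpow_one (n : ℝ)]
      rw [← Real.rpow_add hn0]
      refine Real.rpow_le_one_of_one_le_of_nonpos hn1' ?_
      rw [div_lt_iff₀ (by positivity)] at hα
      push_cast
      linarith
    calc (h n ^ 2) ^ 2 * (n * h n ^ d) = h n ^ (d + 4) * n := by ring
      _ ≤ (c * (n : ℝ) ^ (-α)) ^ (d + 4) * n := by gcongr
      _ = c ^ (d + 4) * (((n : ℝ) ^ (-α)) ^ (d + 4) * n) := by rw [mul_pow]; ring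
      _ ≤ c ^ (d + 4) * 1 := by gcongr
      _ = _ := mul_one _
  have e2 : ((1 + h n) * T) ^ 2 * (n * h n ^ d) ≤ ((1 + c) * (D * B ^ s)) ^ 2 * c ^ d := by
    have hninv : (n : ℝ)⁻¹ ≤ 1 := inv_le_one_of_one_le₀ hn1'
    calc ((1 + h n) * T) ^ 2 * (n * h n ^ d) ≤
          ((1 + c) * (D * B ^ s * (n : ℝ)⁻¹)) ^ 2 * (n * c ^ d) := by gcongr
      _ = ((1 + c) * (D * B ^ s)) ^ 2 * c ^ d * (n : ℝ)⁻¹ := by field_simp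
      _ ≤ _ := mul_le_of_le_one_right (by positivity) hninv
  have h3 : (h n ^ 2 + (1 + h n) * T) ^ 2 ≤ 2 * ((h n ^ 2) ^ 2 + ((1 + h n) * T) ^ 2) := by
    nlinarith [sq_nonneg (h n ^ 2 - (1 + h n) * T)]
  calc _ ≤ 2 * ((h n ^ 2) ^ 2 + ((1 + h n) * T) ^ 2) * (n * h n ^ d) := by gcongr
    _ = 2 * ((h n ^ 2) ^ 2 * (n * h n ^ d) + ((1 + h n) * T) ^ 2 * (n * h n ^ d)) := by ring
    _ ≤ _ := by linarith

end Rates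

/-! ### Uniform mean squared error of kernel averages -/

section MeanSquare

variable {d : ℕ} {Ω 𝒳 𝒴 : Type*} [MeasurableSpace Ω] [MeasurableSpace 𝒳] [MeasurableSpace 𝒴]
  {P : Measure Ω} [IsProbabilityMeasure P] {X : Ω → 𝒳} {Y : Ω → 𝒴}
  {Z : Ω → EuclideanSpace ℝ (Fin d)} {𝒵 : Set (EuclideanSpace ℝ (Fin d))} {μ : Measure (𝒳 × 𝒴)}
  [SigmaFinite μ] {f : 𝒳 × 𝒴 → EuclideanSpace ℝ (Fin d) → ℝ} {fZ : EuclideanSpace ℝ (Fin d) → ℝ}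
  {k₀ : EuclideanSpace ℝ (Fin d) → ℝ}

/-- Uniform mean squared error of the kernel averages. -/
theorem CondR1.exists_integral_sq_kernelAvg_sub_le (hR1 : CondR1 P X Y Z 𝒵 μ f fZ)
    (hR2 : CondR2 𝒵 μ f) (hR3 : CondR3 𝒵 fZ) (hX : Measurable X) (hY : Measurable Y)
    (hZ : Measurable Z) (hZ𝒵 : ∀ᵐ ω ∂P, Z ω ∈ 𝒵) {Xs : ℕ → Ω → 𝒳} {Ys : ℕ → Ω → 𝒴}
    {Zs : ℕ → Ω → EuclideanSpace ℝ (Fin d)}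
    (hindep : iIndepFun (fun i ω => (Xs i ω, Ys i ω, Zs i ω)) P)
    (hident : ∀ i, IdentDistrib (fun ω => (Xs i ω, Ys i ω, Zs i ω))
      (fun ω => (X ω, Y ω, Z ω)) P P)
    (hK1 : CondK1 k₀) (hK2 : CondK2 k₀) {h ε : ℕ → ℝ}
    (hh : ∀ n, 1 ≤ n → 0 < h n) (hε : ∀ n, 1 ≤ n → 0 < ε n) {α β c : ℝ}
    (hα : 1 / ((d : ℝ) + 4) < α) (hβ : 0 < β) (hc : 0 < c)
    (hrate : ∀ n : ℕ, 1 ≤ n → h n ≤ c * (n : ℝ) ^ (-α))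
    (hhε : (fun n => h n / ε n) =O[atTop] fun n : ℕ => (n : ℝ) ^ (-β)) :
    ∃ C, 0 ≤ C ∧ ∀ᶠ n : ℕ in atTop, ∀ g : 𝒳 × 𝒴 → ℝ, Measurable g → (∀ w, |g w| ≤ 1) →
      ∀ z ∈ innerSet 𝒵 (ε n),
        Integrable (fun ω => (kernelAvg k₀ n (h n) (Xs · ω) (Ys · ω) (Zs · ω) z g -
          condMean μ f z g * fZ z) ^ 2) P ∧
        ∫ ω, (kernelAvg k₀ n (h n) (Xs · ω) (Ys · ω) (Zs · ω) z g -
          condMean μ f z g * fZ z) ^ 2 ∂P ≤ C / (n * h n ^ d) := by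
  obtain ⟨A, hA0, hA⟩ := hR1.exists_abs_bias_le hR2 hR3 hX hY hZ hZ𝒵 hK1 hK2
  obtain ⟨B, hB0, hB⟩ := exists_sq_bias_mul_le hK1 hK2 hh hε hα hβ hc hrate hhε
  obtain ⟨D, hD⟩ := hK1.bounded
  obtain ⟨c₀, c₁, hz0, -⟩ := hR3
  have hD0 : 0 ≤ D := (hK1.nonneg 0).trans (hD 0)
  set e := max c₀ 0
  have he0 : 0 ≤ e := le_max_right _ _
  have hae : ∀ᵐ z, fZ z ≤ e := hR1.ae_fZ_le hZ hZ𝒵 he0 fun z hz => (hz0 z hz).trans (le_max_left _ _)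
  -- Variance contributes e·D and squared bias A²·B. The threshold on n is fixed before g and z, so
  -- the bound holds for all basis products and all points at once.
  refine ⟨e * D + A ^ 2 * B, by positivity, ?_⟩
  filter_upwards [hB, eventually_ge_atTop 1] with n hn hn1 g hg hg1 z hz
  have hhn := hh n hn1
  have hn0 : (0 : ℝ) < n := by exact_mod_cast hn1
  set G : 𝒳 × 𝒴 × EuclideanSpace ℝ (Fin d) → ℝ := fun t =>
    g (t.1, t.2.1) * scaledKernel k₀ (h n) (z - t.2.2) with hGdef
  have hkm : Measurable fun x => scaledKernel k₀ (h n) (z - x) :=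
    (measurable_scaledKernel hK1 _).comp (by fun_prop)
  have hG : Measurable G :=
    (hg.comp (measurable_fst.prodMk (measurable_fst.comp measurable_snd))).mul
      (hkm.comp (measurable_snd.comp measurable_snd))
  have hGk : ∀ t, |G t| ≤ scaledKernel k₀ (h n) (z - t.2.2) := fun t => by
    have h0 := scaledKernel_nonneg hK1.nonneg hhn (z - t.2.2)
    rw [hGdef, abs_mul, abs_of_nonneg h0]
    exact mul_le_of_le_one_left h0 (hg1 _)
  have hGb : ∀ t, |G t| ≤ D / h n ^ d := fun t => (hGk t).trans (scaledKernel_le hD hhn _)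
  have hv : ∫ ω, G (X ω, Y ω, Z ω) ^ 2 ∂P ≤ e * (D / h n ^ d) := by
    refine le_trans ?_ (hR1.integral_scaledKernel_sq_le hZ hK1 he0 hae hD hhn z)
    refine integral_mono_of_nonneg (ae_of_all _ fun ω => sq_nonneg _) ?_ (ae_of_all _ fun ω => ?_)
    · refine Integrable.of_bound ((hkm.comp hZ).pow_const 2).aestronglyMeasurable ((D / h n ^ d) ^ 2)
        (ae_of_all _ fun ω => ?_)
      have h0 := scaledKernel_nonneg hK1.nonneg hhn (z - Z ω)
      have h1 := scaledKernel_le hD hhn (z - Z ω)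
      simp only [norm_pow, Real.norm_of_nonneg h0]
      gcongr
    · exact sq_le_sq.2 ((hGk _).trans (le_abs_self _))
  obtain ⟨hI, hle⟩ := integral_sq_average_sub_le hindep hident hG hGb hv
    (hA g hg hg1 (h n) (ε n) hhn (hε n hn1) z hz) (Nat.one_le_iff_ne_zero.1 hn1)
  refine ⟨hI, hle.trans ?_⟩
  rw [mul_pow]
  set Q := (h n ^ 2 + (1 + h n) * kernelTail k₀ (ε n / h n)) ^ 2
  have hQ : Q ≤ B / (n * h n ^ d) := by rwa [le_div_iff₀ (by positivity)]
  calc e * (D / h n ^ d) / n + A ^ 2 * Q ≤ e * (D / h n ^ d) / n + A ^ 2 * (B / (n * h n ^ d)) := by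
        gcongr
    _ = _ := by field_simp

end MeanSquare

/-! ### Total deviation of the moment estimates -/

section Deviation

variable {d : ℕ} {𝒳 𝒴 : Type*} {k₀ : EuclideanSpace ℝ (Fin d) → ℝ}

/-- Sum of squared errors of the kernel averages of all products of basis functions. -/
def kernelDeviation (k₀ : EuclideanSpace ℝ (Fin d) → ℝ) (n : ℕ) (h : ℝ)
    (x : ℕ → 𝒳) (y : ℕ → 𝒴) (z' : ℕ → EuclideanSpace ℝ (Fin d)) (z : EuclideanSpace ℝ (Fin d))
    (E : (𝒳 × 𝒴 → ℝ) → ℝ) (r : ℝ) {p q : ℕ} (φ : Fin p → 𝒳 → ℝ) (ψ : Fin q → 𝒴 → ℝ) : ℝ :=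
  ∑ s, ∑ t, (kernelAvg k₀ n h x y z' z (fun w => basisFun φ ψ s w * basisFun φ ψ t w) -
    E (fun w => basisFun φ ψ s w * basisFun φ ψ t w) * r) ^ 2

variable {n : ℕ} {h : ℝ} {x : ℕ → 𝒳} {y : ℕ → 𝒴} {z' : ℕ → EuclideanSpace ℝ (Fin d)}
  {z : EuclideanSpace ℝ (Fin d)} {E : (𝒳 × 𝒴 → ℝ) → ℝ} {r : ℝ} {p q : ℕ} {φ : Fin p → 𝒳 → ℝ}
  {ψ : Fin q → 𝒴 → ℝ}

theorem kernelDeviation_nonneg : 0 ≤ kernelDeviation k₀ n h x y z' z E r φ ψ :=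
  Finset.sum_nonneg fun _ _ => Finset.sum_nonneg fun _ _ => sq_nonneg _

/-- A maximum over pairs is dominated by a sum of squares, whose expectation can be bounded term by
term. -/
theorem abs_kernelAvg_sub_le_sqrt (s t : Option (Fin p ⊕ Fin q)) :
    |kernelAvg k₀ n h x y z' z (fun w => basisFun φ ψ s w * basisFun φ ψ t w) -
      E (fun w => basisFun φ ψ s w * basisFun φ ψ t w) * r| ≤
      √(kernelDeviation k₀ n h x y z' z E r φ ψ) := by
  refine Real.abs_le_sqrt ?_
  refine le_trans ?_ (Finset.single_le_sum (fun s _ => Finset.sum_nonneg fun t _ => sq_nonneg _)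
    (Finset.mem_univ s))
  exact Finset.single_le_sum (f := fun t =>
    (kernelAvg k₀ n h x y z' z (fun w => basisFun φ ψ s w * basisFun φ ψ t w) -
      E (fun w => basisFun φ ψ s w * basisFun φ ψ t w) * r) ^ 2) (fun t _ => sq_nonneg _)
    (Finset.mem_univ t)

end Deviation

theorem sum_sq_le_of_abs_le_sqrt {m : ℕ} {a D : Fin m → ℝ} {K : ℝ} (hD : ∀ k, 0 ≤ D k)
    (h : ∀ k, |a k| ≤ K * √(D k)) : ∑ k, a k ^ 2 ≤ K ^ 2 * ∑ k, D k := by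
  rw [Finset.mul_sum]
  refine Finset.sum_le_sum fun k _ => ?_
  have := pow_le_pow_left₀ (abs_nonneg _) (h k) 2
  rwa [sq_abs, mul_pow, Real.sq_sqrt (hD k)] at this

end

/-! ### Assembly of the stability and mean squared error bounds -/

theorem theorem3p1 {d : ℕ} {Ω 𝒳 𝒴 : Type*}
    [MeasurableSpace Ω] [MeasurableSpace 𝒳] [MeasurableSpace 𝒴]
    (P : Measure Ω) [IsProbabilityMeasure P]
    -- the random elements X, Y, Z; Z takes its values in 𝒵
    (X : Ω → 𝒳) (Y : Ω → 𝒴) (Z : Ω → EuclideanSpace ℝ (Fin d))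
    (hX : Measurable X) (hY : Measurable Y) (hZ : Measurable Z)
    (𝒵 : Set (EuclideanSpace ℝ (Fin d))) (hZ𝒵 : ∀ᵐ ω ∂P, Z ω ∈ 𝒵)
    -- the i.i.d. observations
    (Xs : ℕ → Ω → 𝒳) (Ys : ℕ → Ω → 𝒴) (Zs : ℕ → Ω → EuclideanSpace ℝ (Fin d))
    (hindep : iIndepFun (fun i ω => (Xs i ω, Ys i ω, Zs i ω)) P)
    (hident : ∀ i, IdentDistrib (fun ω => (Xs i ω, Ys i ω, Zs i ω))
      (fun ω => (X ω, Y ω, Z ω)) P P)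
    -- the basis functions
    (Λ₁ Λ₂ Λ₃ : Set ℕ)
    (hΛ₁ : Λ₁.Infinite ∧ ∀ p ∈ Λ₁, 0 < p) (hΛ₂ : Λ₂.Infinite ∧ ∀ q ∈ Λ₂, 0 < q)
    (hΛ₃ : Λ₃.Infinite ∧ ∀ r ∈ Λ₃, 0 < r)
    (φ : (p : ℕ) → Fin p → 𝒳 → ℝ) (ψ : (q : ℕ) → Fin q → 𝒴 → ℝ)
    (θ : (r : ℕ) → Fin r → EuclideanSpace ℝ (Fin d) → ℝ)
    (hφ : ∀ p i, Measurable (φ p i)) (hψ : ∀ q j, Measurable (ψ q j))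
    (hθ : ∀ r k, Measurable (θ r k))
    (happ₁ : TensorApprox P X Z Λ₁ Λ₃ φ θ) (happ₂ : TensorApprox P Y Z Λ₂ Λ₃ ψ θ)
    (hbasis₁ : SpansOne Λ₁ φ) (hbasis₂ : SpansOne Λ₂ ψ)
    -- the densities
    (μ : Measure (𝒳 × 𝒴)) [SigmaFinite μ]
    (f : 𝒳 × 𝒴 → EuclideanSpace ℝ (Fin d) → ℝ) (fZ : EuclideanSpace ℝ (Fin d) → ℝ)
    (hR1 : CondR1 P X Y Z 𝒵 μ f fZ) (hR2 : CondR2 𝒵 μ f) (hR3 : CondR3 𝒵 fZ)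
    -- the kernel
    (k₀ : EuclideanSpace ℝ (Fin d) → ℝ) (hK1 : CondK1 k₀) (hK2 : CondK2 k₀)
    -- the bandwidths
    (h ε : ℕ → ℝ) (hh : ∀ n, 1 ≤ n → 0 < h n) (hε : ∀ n, 1 ≤ n → 0 < ε n)
    (α β c₃₁ c₃₂ : ℝ) (hα : 1 / ((d : ℝ) + 4) < α ∧ α < 1 / (d : ℝ)) (hβ : 0 < β)
    (hc₃₁ : 0 < c₃₁) (hc₃₂ : 0 < c₃₂)
    (hrate : ∀ n : ℕ, 1 ≤ n → c₃₁ * (n : ℝ) ^ (-α) ≤ h n ∧ h n ≤ c₃₂ * (n : ℝ) ^ (-α))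
    (hhε : (fun n => h n / ε n) =O[atTop] fun n : ℕ => (n : ℝ) ^ (-β))
    -- the points z_1, ..., z_{n_Z} (depending on n) and the numbers p_n, q_n
    (nZ : ℕ → ℕ) (z : (n : ℕ) → Fin (nZ n) → EuclideanSpace ℝ (Fin d))
    (hz : ∀ n, 1 ≤ n → ∀ k, z n k ∈ innerSet 𝒵 (ε n))
    (hsep : ∀ᶠ n in atTop, ∀ k k', k ≠ k' → h n ≤ ‖z n k - z n k'‖)
    (p q : ℕ → ℕ) (hp : ∀ n, 1 ≤ n → p n ∈ Λ₁) (hq : ∀ n, 1 ≤ n → q n ∈ Λ₂)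
    -- (B1): the basis functions are bounded by 1
    (hB1 : (∀ p ∈ Λ₁, ∀ i x, |φ p i x| ≤ 1) ∧ ∀ q ∈ Λ₂, ∀ j y, |ψ q j y| ≤ 1)
    -- (B2): all eigenvalues of V₁₁(z_k) and V₂₂(z_k) are at least δ_n > 0
    (δ : ℕ → ℝ) (hδ : ∀ n, 1 ≤ n → 0 < δ n)
    (hB2 : ∀ n, 1 ≤ n → ∀ k,
      (∀ t ∈ spectrum ℝ
        (secondMomentMatrix (condMean μ f (z n k)) fun i w => φ (p n) i w.1), δ n ≤ t) ∧
      ∀ t ∈ spectrum ℝ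
        (secondMomentMatrix (condMean μ f (z n k)) fun j w => ψ (q n) j w.2), δ n ≤ t)
    (hsmall : (fun n => (nZ n : ℝ) * ((p n : ℝ) + q n) ^ 2 *
        max 1 ((δ n)⁻¹ * ((p n : ℝ) + q n)))
      =O[atTop] fun n : ℕ => Real.log n ^ (1 / 16 : ℝ)) :
    let ρ : (n : ℕ) → Fin (nZ n) → ℝ := fun n k =>
      maxBasisCorr (condMean μ f (z n k)) (φ (p n)) (ψ (q n))
    let ρhat : (n : ℕ) → Fin (nZ n) → Ω → ℝ := fun n k ω =>
      maxBasisCorr (kernelMean k₀ n (h n) (Xs · ω) (Ys · ω) (Zs · ω) (z n k)) (φ (p n)) (ψ (q n))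
    let fhat : (n : ℕ) → Fin (nZ n) → Ω → ℝ := fun n k ω =>
      kernelDensity k₀ n (h n) (Zs · ω) (z n k)
    IsBigOP P (fun n ω => ∑ k, (ρhat n k ω ^ 2 - ρ n k ^ 2) ^ 2)
      (fun n => ((n : ℝ) * h n ^ d)⁻¹ * Real.log n ^ (1 / 4 : ℝ)) ∧
    IsBigOP P (fun n ω => (∑ k, fhat n k ω * ρhat n k ω ^ 2 - ∑ k, fZ (z n k) * ρ n k ^ 2) ^ 2)
      (fun n => Real.log n ^ (5 / 16 : ℝ) / ((n : ℝ) * h n ^ d)) := by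
  intro ρ ρhat fhat
  obtain ⟨C, hC0, hC⟩ := hR1.exists_integral_sq_kernelAvg_sub_le hR2 hR3 hX hY hZ hZ𝒵 hindep hident
    hK1 hK2 hh hε hα.1 hβ hc₃₂ (fun n hn => (hrate n hn).2) hhε
  obtain ⟨c₀, c₁, hz0, -, -, hz3⟩ := hR3
  obtain ⟨B, hB0, hB⟩ := hsmall.exists_pos
  set c := max c₀ 0
  have hc0 : 0 ≤ c := le_max_right _ _
  set c' := max c₁ 0
  have hc'0 : 0 ≤ c' := le_max_right _ _
  -- Expanded, this covers 64c' for the squared correlation and 1 + 64cc' for its product with the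
  -- density.
  set A := (1 + c) * (64 * c' + 1) with hA
  have hA0 : 0 ≤ A := by positivity
  set K : ℕ → ℝ := fun n => max 1 ((δ n)⁻¹ * ((p n : ℝ) + q n)) with hK
  set Dev : (n : ℕ) → Fin (nZ n) → Ω → ℝ := fun n k ω =>
    kernelDeviation k₀ n (h n) (Xs · ω) (Ys · ω) (Zs · ω) (z n k) (condMean μ f (z n k))
      (fZ (z n k)) (φ (p n)) (ψ (q n)) with hDev
  -- A common bound for both claims; the leading factor n_Z is the Cauchy–Schwarz cost of squaring
  -- the sum in the second one.
  set S : ℕ → Ω → ℝ := fun n ω => (nZ n * (A * K n) ^ 2) * ∑ k, Dev n k ω with hS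
  -- the deterministic bounds
  have hbound : ∀ n, 1 ≤ n → ∀ ω,
      |∑ k, (ρhat n k ω ^ 2 - ρ n k ^ 2) ^ 2| ≤ S n ω ∧
      |(∑ k, fhat n k ω * ρhat n k ω ^ 2 - ∑ k, fZ (z n k) * ρ n k ^ 2) ^ 2| ≤ S n ω := by
    intro n hn ω
    have hK1' : 1 ≤ K n := le_max_left _ _
    have hD0 : ∀ k, 0 ≤ Dev n k ω := fun k => kernelDeviation_nonneg
    have hpt : ∀ k, |ρhat n k ω ^ 2 - ρ n k ^ 2| ≤ (A * K n) * √(Dev n k ω) ∧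
        |fhat n k ω * ρhat n k ω ^ 2 - fZ (z n k) * ρ n k ^ 2| ≤ (A * K n) * √(Dev n k ω) := by
      intro k
      have hmem : z n k ∈ 𝒵 := (hz n hn k).1
      have hf0 := hR1.f_nonneg _ hmem
      set ν := μ.withDensity fun w => ENNReal.ofReal (f w (z n k))
      have hE : ∀ g, condMean μ f (z n k) g = ∫ w, g w ∂ν :=
        condMean_eq_integral hR1.measurable_f hf0
      have hν : IsProbabilityMeasure ν := ⟨by
        rw [withDensity_apply _ MeasurableSet.univ, Measure.restrict_univ]
        exact hR1.f_mass _ hmem⟩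
      obtain ⟨hfpos, hfinv⟩ := hz3 _ hmem
      have hφb := hB1.1 (p n) (hp n hn)
      have hψb := hB1.2 (q n) (hq n hn)
      have hdev : ∀ s t, |kernelAvg k₀ n (h n) (Xs · ω) (Ys · ω) (Zs · ω) (z n k)
          (fun w => basisFun (φ (p n)) (ψ (q n)) s w * basisFun (φ (p n)) (ψ (q n)) t w) -
          condMean μ f (z n k) (fun w => basisFun (φ (p n)) (ψ (q n)) s w *
            basisFun (φ (p n)) (ψ (q n)) t w) * fZ (z n k)| ≤ √(Dev n k ω) := fun s t =>
        abs_kernelAvg_sub_le_sqrt s t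
      have hmain : |ρhat n k ω - ρ n k| ≤ 32 * c' * K n * √(Dev n k ω) :=
        abs_maxBasisCorr_kernelMean_sub_le hE (hφ _) (hψ _) hφb hψb
          (hbasis₁ _ (hp n hn)) (hbasis₂ _ (hq n hn)) (hδ n hn) (hB2 n hn k).1 (hB2 n hn k).2
          hK1.nonneg (hh n hn) (Nat.one_le_iff_ne_zero.1 hn) hfpos (hfinv.trans (le_max_left _ _))
          hdev
      obtain ⟨l0, l1⟩ : 0 ≤ ρhat n k ω ∧ ρhat n k ω ≤ 1 :=
        maxBasisCorr_kernelMean_mem (hφ _) (hψ _) hφb hψb hK1.nonneg (hh n hn)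
      obtain ⟨m0, m1⟩ : 0 ≤ ρ n k ∧ ρ n k ≤ 1 := maxBasisCorr_mem hE (hφ _) (hψ _) hφb hψb
      have hfd : |fhat n k ω - fZ (z n k)| ≤ √(Dev n k ω) := by
        have h1 := hdev none none
        simp only [basisFun, mul_one, hE, integral_const, probReal_univ, smul_eq_mul, one_mul] at h1
        rwa [← kernelDensity_eq_kernelAvg] at h1
      have hfc : fZ (z n k) ≤ c := (le_abs_self _).trans ((hz0 _ hmem).trans (le_max_left _ _))
      have hs0 := Real.sqrt_nonneg (Dev n k ω)
      set s := √(Dev n k ω)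
      have hKs : 0 ≤ K n * s := by positivity
      have hsq : |ρhat n k ω ^ 2 - ρ n k ^ 2| ≤ 64 * c' * (K n * s) := by
        have e : ρhat n k ω ^ 2 - ρ n k ^ 2 = (ρhat n k ω + ρ n k) * (ρhat n k ω - ρ n k) := by ring
        rw [e, abs_mul, abs_of_nonneg (by linarith)]
        calc _ ≤ 2 * (32 * c' * K n * s) :=
              mul_le_mul (by linarith) hmain (abs_nonneg _) zero_le_two
          _ = _ := by ring
      have hsK : s ≤ K n * s := le_mul_of_one_le_left hs0 hK1'
      have hA1 : A * K n * s = 64 * c' * (K n * s) + c * (64 * c' * (K n * s)) + K n * s +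
        c * (K n * s) := by rw [hA]; ring
      have t1 : 0 ≤ c * (64 * c' * (K n * s)) := by positivity
      have t2 : 0 ≤ c * (K n * s) := by positivity
      have t3 : 0 ≤ 64 * c' * (K n * s) := by positivity
      refine ⟨by linarith, ?_⟩
      have e : fhat n k ω * ρhat n k ω ^ 2 - fZ (z n k) * ρ n k ^ 2 =
          (fhat n k ω - fZ (z n k)) * ρhat n k ω ^ 2 +
          fZ (z n k) * (ρhat n k ω ^ 2 - ρ n k ^ 2) := by ring
      rw [e]
      have q1 : |(fhat n k ω - fZ (z n k)) * ρhat n k ω ^ 2| ≤ s := by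
        rw [abs_mul, abs_of_nonneg (sq_nonneg (ρhat n k ω))]
        exact (mul_le_of_le_one_right (abs_nonneg _) (pow_le_one₀ l0 l1)).trans hfd
      have q2 : |fZ (z n k) * (ρhat n k ω ^ 2 - ρ n k ^ 2)| ≤ c * (64 * c' * (K n * s)) := by
        rw [abs_mul, abs_of_pos hfpos]
        exact mul_le_mul hfc hsq (abs_nonneg _) hc0
      exact (abs_add_le _ _).trans (by linarith)
    have hsum0 : 0 ≤ ∑ k, Dev n k ω := Finset.sum_nonneg fun k _ => hD0 k
    rw [abs_of_nonneg (Finset.sum_nonneg fun k _ => sq_nonneg _), abs_of_nonneg (sq_nonneg _)]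
    constructor
    · refine (sum_sq_le_of_abs_le_sqrt hD0 fun k => (hpt k).1).trans ?_
      -- The factor n_Z can be inserted freely when it is at least 1; with no points both sides
      -- vanish.
      rcases Nat.eq_zero_or_pos (nZ n) with h0 | h0
      · have : IsEmpty (Fin (nZ n)) := by rw [h0]; infer_instance
        simp [hS]
      · have : (1 : ℝ) ≤ nZ n := by exact_mod_cast h0
        exact mul_le_mul_of_nonneg_right (le_mul_of_one_le_left (sq_nonneg _) this) hsum0
    · rw [← Finset.sum_sub_distrib]
      have h1 := sq_sum_le_card_mul_sum_sq (s := Finset.univ)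
        (f := fun k => fhat n k ω * ρhat n k ω ^ 2 - fZ (z n k) * ρ n k ^ 2)
      simp only [Finset.card_univ, Fintype.card_fin] at h1
      refine h1.trans ?_
      simp only [hS]
      rw [mul_assoc]
      exact mul_le_mul_of_nonneg_left (sum_sq_le_of_abs_le_sqrt hD0 fun k => (hpt k).2)
        (Nat.cast_nonneg _)
  -- the expectation of the bound
  have hexp : ∀ᶠ n : ℕ in atTop, 1 ≤ n ∧ 1 ≤ Real.log n ∧ Integrable (S n) P ∧
      ∫ ω, S n ω ∂P ≤ 4 * A ^ 2 * C * B ^ 2 * (Real.log n ^ (1 / 8 : ℝ) / (n * h n ^ d)) := by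
    have hlog : ∀ᶠ n : ℕ in atTop, 1 ≤ Real.log n :=
      (Real.tendsto_log_atTop.comp tendsto_natCast_atTop_atTop).eventually_ge_atTop 1
    filter_upwards [hC, hB.bound, hlog, eventually_ge_atTop 1] with n hCn hBn hln hn
    have hKn : 1 ≤ K n := le_max_left _ _
    have hhn := hh n hn
    have hn0 : (0 : ℝ) < n := by exact_mod_cast hn
    have hN : 0 < (n : ℝ) * h n ^ d := by positivity
    have hφb := hB1.1 (p n) (hp n hn)
    have hψb := hB1.2 (q n) (hq n hn)
    have hterm := fun k s t => hCn
      (fun w => basisFun (φ (p n)) (ψ (q n)) s w * basisFun (φ (p n)) (ψ (q n)) t w)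
      ((measurable_basisFun (hφ _) (hψ _) s).mul (measurable_basisFun (hφ _) (hψ _) t))
      (fun w => by
        rw [abs_mul]
        exact mul_le_one₀ (abs_basisFun_le hφb hψb s w) (abs_nonneg _)
          (abs_basisFun_le hφb hψb t w)) (z n k) (hz n hn k)
    have hDi : ∀ k, Integrable (Dev n k) P := fun k =>
      integrable_finsetSum _ fun s _ => integrable_finsetSum _ fun t _ => (hterm k s t).1
    have hDle : ∀ k, ∫ ω, Dev n k ω ∂P ≤ ((p n : ℝ) + q n + 1) ^ 2 * (C / (n * h n ^ d)) := by
      intro k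
      simp only [hDev, kernelDeviation]
      rw [integral_finsetSum _ fun s _ => integrable_finsetSum _ fun t _ => (hterm k s t).1]
      calc _ ≤ ∑ _s : Option (Fin (p n) ⊕ Fin (q n)), ∑ _t : Option (Fin (p n) ⊕ Fin (q n)),
            C / (n * h n ^ d) := by
            refine Finset.sum_le_sum fun s _ => ?_
            rw [integral_finsetSum _ fun t _ => (hterm k s t).1]
            exact Finset.sum_le_sum fun t _ => (hterm k s t).2
        _ = _ := by simp; ring
    refine ⟨hn, hln, (integrable_finsetSum _ fun k _ => hDi k).const_mul _, ?_⟩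
    simp only [hS]
    rw [integral_const_mul, integral_finsetSum _ fun k _ => hDi k]
    have hpq : (1 : ℝ) ≤ (p n : ℝ) + q n := by
      have := hΛ₁.2 _ (hp n hn)
      have h1 : (1 : ℝ) ≤ p n := by exact_mod_cast this
      have h2 : (0 : ℝ) ≤ q n := Nat.cast_nonneg _
      linarith
    set m := (p n : ℝ) + q n
    have hlog0 : 0 ≤ Real.log n := by linarith
    have hBn' : (nZ n : ℝ) * m ^ 2 * K n ≤ B * Real.log n ^ (1 / 16 : ℝ) := by
      rw [Real.norm_of_nonneg (by positivity), Real.norm_of_nonneg (by positivity)] at hBn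
      exact hBn
    have hL : (Real.log n ^ (1 / 16 : ℝ)) ^ 2 = Real.log n ^ (1 / 8 : ℝ) := by
      rw [← Real.rpow_natCast, ← Real.rpow_mul hlog0]; norm_num
    calc (nZ n * (A * K n) ^ 2) * ∑ k, ∫ ω, Dev n k ω ∂P ≤
          (nZ n * (A * K n) ^ 2) * ∑ _k : Fin (nZ n), (m + 1) ^ 2 * (C / (n * h n ^ d)) := by
          gcongr with k
          exact hDle k
      _ = A ^ 2 * C * ((nZ n * K n) * (nZ n * (m + 1) ^ 2 * K n)) / (n * h n ^ d) := by
          simp; ring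
      -- As m ≥ 1, one factor is enlarged by m² and m + 1 ≤ 2m in the other, so the square of the
      -- quantity in the growth condition appears.
      _ ≤ A ^ 2 * C * ((nZ n * m ^ 2 * K n) * (nZ n * (2 * m) ^ 2 * K n)) / (n * h n ^ d) := by
          have h1 : (1 : ℝ) ≤ m ^ 2 := one_le_pow₀ hpq
          gcongr
          · exact le_mul_of_one_le_right (Nat.cast_nonneg _) h1
          · linarith
      _ = 4 * A ^ 2 * C * (nZ n * m ^ 2 * K n) ^ 2 / (n * h n ^ d) := by ring
      _ ≤ 4 * A ^ 2 * C * (B * Real.log n ^ (1 / 16 : ℝ)) ^ 2 / (n * h n ^ d) := by gcongr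
      _ = _ := by rw [mul_pow B, hL]; ring
  -- Once ln n ≥ 1, the exponent 1/8 may be raised to any a ≥ 1/8.
  have hfinal : ∀ {R : ℕ → Ω → ℝ} {r : ℕ → ℝ} {a : ℝ}, 1 / 8 ≤ a →
      (∀ n : ℕ, r n = Real.log n ^ a / (n * h n ^ d)) →
      (∀ n, 1 ≤ n → ∀ ω, |R n ω| ≤ S n ω) → IsBigOP P R r := by
    intro R r a ha hr hR
    refine isBigOP_of_integral_le (S := S) (C := 4 * A ^ 2 * C * B ^ 2) ?_
    filter_upwards [hexp] with n ⟨hn, hln, hI, hle⟩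
    have hhn := hh n hn
    have hn0 : (0 : ℝ) < n := by exact_mod_cast hn
    rw [hr]
    refine ⟨?_, hR n hn, hI, hle.trans ?_⟩
    · have : 0 < Real.log n := by linarith
      positivity
    · gcongr
  refine ⟨hfinal (a := 1 / 4) (by norm_num) (fun n => (div_eq_inv_mul _ _).symm)
    fun n hn ω => (hbound n hn ω).1,
    hfinal (a := 5 / 16) (by norm_num) (fun n => rfl) fun n hn ω => (hbound n hn ω).2⟩
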